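/- Let $\mathbb Z^2_{even}=\{(x,t)\in\mathbb Z^2: x+t \text{ even}\}$. In the dynamical discrete web every site $z=(x,t)\in\mathbb Z^2_{even}$ carries an arrow $\xi^\tau_z\in\{-1,+1\}$, $\tau\ge 0$, pointing from $(x,t)$ to $(x+\xi^\tau_z,t+1)$: at $\tau=0$ the arrows are independent and take the values $\pm1$ with probability $1/2$ each, and at the rings of a rate-one Poisson clock attached to $z$ the arrow at $z$ is reset to a fresh value $\pm1$ with probability $1/2$ each, all clocks, initial arrows and resets being independent. For $\tau\ge0$ let $S^\tau_0=(S^\tau_0(t))_{t\ge0}$ be the piecewise linear path that starts at the origin $(0,0)$ and follows the arrows $(\xi^\tau_z)_z$ present at dynamical time $\tau$, and let $S$ be a (linearly interpolated) simple symmetric random walk on $\mathbb Z$ started at $0$. For $\delta>0$ and a continuous path $\pi$ on $[0,\infty)$ let $\tilde\pi(t)=\delta\,\pi(t/\delta^2)$, $t\in[0,1]$, and let $$O=\{\pi\in C([0,1]):\ \pi(t)>-1 \text{ for all } t\in[0,1],\ \text{ and } \pi(1)>1\}.$$ Then there exist constants $K,a\in(0,\infty)$ such that for all $\delta>0$ and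 all $\tau,\tau'\ge0$ with $\tau\ne\tau'$, $$\mathbb P\big(\tilde S^\tau_0\in O,\ \tilde S^{\tau'}_0\in O\big)\ \le\ \mathbb P\big(\tilde S\in O\big)^2+K\Big(\frac{\delta}{|\tau-\tau'|}\Big)^a .$$ -/

import Mathlib

open MeasureTheory ProbabilityTheory
open scoped NNReal

namespace DyDW

noncomputable section

/-! ### The discrete web -/

/-- The even sublattice `{(x, t) ∈ ℤ² : x + t even}` of discrete space-time. -/
abbrev ZEven : Type := {z : ℤ × ℤ // Even (z.1 + z.2)}

/-- The space-time origin. -/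
def origin : ZEven := ⟨(0, 0), by simp⟩

/-- The increment carried by an arrow: `true` points right, `false` points left. -/
def incr (b : Bool) : ℤ := if b then 1 else -1

/-- Following the arrow `b` from `(x, t)` leads to `(x ± 1, t + 1)`. -/
def step (z : ZEven) (b : Bool) : ZEven :=
  ⟨(z.1.1 + incr b, z.1.2 + 1), by
    obtain ⟨k, hk⟩ := z.2
    cases b
    · exact ⟨k, by simp [incr]; omega⟩
    · exact ⟨k + 1, by simp [incr]; omega⟩⟩

/-- The space-time point reached from `z` after following `n` arrows of the configuration `A`. -/
def follow (A : ZEven → Bool) (z : ZEven) (n : ℕ) : ZEven :=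
  (fun w => step w (A w))^[n] z

/-- The (integer-time) path from the origin in the discrete web of the arrow configuration `A`. -/
def pathFromOrigin (A : ZEven → Bool) (n : ℕ) : ℤ := (follow A origin n).1.1

/-! ### Piecewise linear paths and diffusive rescaling -/

/-- Linear interpolation of an integer-time path. -/
def interp (s : ℕ → ℤ) (t : ℝ≥0) : ℝ :=
  (s ⌊t⌋₊ : ℝ) + ((t : ℝ) - (⌊t⌋₊ : ℝ)) * ((s (⌊t⌋₊ + 1) : ℝ) - (s ⌊t⌋₊ : ℝ))

theorem interp_eq_of_mem (s : ℕ → ℤ) (n : ℕ) (t : ℝ≥0)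
    (ht : t ∈ Set.Icc (n : ℝ≥0) ((n : ℝ≥0) + 1)) :
    interp s t = (s n : ℝ) + ((t : ℝ) - (n : ℝ)) * ((s (n + 1) : ℝ) - (s n : ℝ)) := by
  rcases lt_or_eq_of_le ht.2 with h | h
  · have hf : ⌊t⌋₊ = n := (Nat.floor_eq_iff (by positivity)).2 ⟨ht.1, h⟩
    simp only [interp, hf]
  · have hf : ⌊t⌋₊ = n + 1 := by
      rw [h]; exact_mod_cast Nat.floor_natCast (R := ℝ≥0) (n + 1)
    simp only [interp, hf]
    rw [h]
    push_cast
    ring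

theorem continuous_interp (s : ℕ → ℤ) : Continuous (interp s) := by
  have hlf : LocallyFinite fun n : ℕ => Set.Icc (n : ℝ≥0) ((n : ℝ≥0) + 1) := by
    intro x
    refine ⟨Set.Iio (x + 1), Iio_mem_nhds (by simp), ?_⟩
    refine (Set.finite_Iio (⌈x + 1⌉₊)).subset ?_
    rintro n ⟨y, hy, hyx⟩
    have h : (n : ℝ≥0) < x + 1 := lt_of_le_of_lt hy.1 hyx
    exact Set.mem_Iio.2 (Nat.lt_ceil.2 h)
  refine hlf.continuous ?_ (fun _ => isClosed_Icc) ?_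
  · refine Set.eq_univ_of_forall fun t => Set.mem_iUnion.2 ⟨⌊t⌋₊, ?_, ?_⟩
    · exact Nat.floor_le (by positivity)
    · exact (Nat.lt_floor_add_one t).le
  · intro n
    refine ContinuousOn.congr ?_ (interp_eq_of_mem s n)
    fun_prop

/-- The continuous piecewise linear path on `[0, ∞)` through an integer-time path. -/
def toPath (s : ℕ → ℤ) : C(ℝ≥0, ℝ) := ⟨interp s, continuous_interp s⟩

/-- The diffusive rescaling `t ↦ π (t / δ²) δ`, as a path on `[0, 1]`. -/
def rescale (δ : ℝ≥0) (π : C(ℝ≥0, ℝ)) : C(unitInterval, ℝ) where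
  toFun t := π (unitInterval.toNNReal t / δ ^ 2) * (δ : ℝ)
  continuous_toFun := by
    have h : Continuous fun t : unitInterval => unitInterval.toNNReal t / δ ^ 2 := by
      simp only [div_eq_mul_inv]
      exact unitInterval.toNNReal_continuous.mul continuous_const
    exact (π.continuous.comp h).mul continuous_const

/-- The paths on `[0, 1]` that stay above `-1` and end above `1`. -/
def O : Set C(unitInterval, ℝ) := {π | (∀ t, -1 < π t) ∧ 1 < π 1}

/-! ### Simple symmetric random walk -/

/-- `S` is a simple symmetric random walk started at `0`. -/
structure IsSimpleSymmetricWalk {Ω : Type*} [MeasurableSpace Ω] (P : Measure Ω)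
    (S : ℕ → Ω → ℤ) : Prop where
  measurable : ∀ n, Measurable (S n)
  start : ∀ᵐ ω ∂P, S 0 ω = 0
  incr_right : ∀ n, P {ω | S (n + 1) ω - S n ω = 1} = 1 / 2
  incr_left : ∀ n, P {ω | S (n + 1) ω - S n ω = -1} = 1 / 2
  indep : iIndepFun (fun (n : ℕ) (ω : Ω) => S (n + 1) ω - S n ω) P

/-! ### The dynamical discrete web -/

/-- `N` is the counting process of a rate one Poisson clock: `N t` is the number of rings
in `(0, t]`. -/
structure IsPoissonClock {Ω : Type*} [MeasurableSpace Ω] (P : Measure Ω)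
    (N : ℝ≥0 → Ω → ℕ) : Prop where
  measurable : ∀ t, Measurable (N t)
  start : ∀ᵐ ω ∂P, N 0 ω = 0
  mono : ∀ᵐ ω ∂P, Monotone fun t => N t ω
  rightCts : ∀ᵐ ω ∂P, ∀ t, ContinuousWithinAt (fun s => N s ω) (Set.Ioi t) t
  law : ∀ s t, s ≤ t → P.map (fun ω => N t ω - N s ω) = poissonMeasure (t - s)
  indep : HasIndepIncrements N P

/-- The random input of the dynamical discrete web. The site `z` carries the clock `N z`, the
initial arrow `η z 0`, and the arrow `η z n` to which it is reset at the `n`-th ring, `n ≥ 1`.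
The arrows are fair, the clocks are rate one Poisson processes, and all of them are independent. -/
structure IsDynamics {Ω : Type*} [MeasurableSpace Ω] (P : Measure Ω)
    (η : ZEven → ℕ → Ω → Bool) (N : ZEven → ℝ≥0 → Ω → ℕ) : Prop where
  measurable_arrow : ∀ z n, Measurable (η z n)
  fair : ∀ z n, P {ω | η z n ω = true} = 1 / 2
  clock : ∀ z, IsPoissonClock P (N z)
  indep_arrows : iIndepFun (fun (p : ZEven × ℕ) (ω : Ω) => η p.1 p.2 ω) P
  indep_clocks : iIndepFun (fun (z : ZEven) (ω : Ω) (t : ℝ≥0) => N z t ω) P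
  indep_arrows_clocks :
    IndepFun (fun (ω : Ω) (p : ZEven × ℕ) => η p.1 p.2 ω)
      (fun (ω : Ω) (z : ZEven) (t : ℝ≥0) => N z t ω) P

/-- The arrow configuration at dynamical time `τ`: each site shows its latest arrow. -/
def config {Ω : Type*} (η : ZEven → ℕ → Ω → Bool) (N : ZEven → ℝ≥0 → Ω → ℕ)
    (τ : ℝ≥0) (ω : Ω) : ZEven → Bool :=
  fun z => η z (N z τ ω) ω

/-- The path from the origin in the dynamical discrete web at dynamical time `τ`. -/
def walk {Ω : Type*} (η : ZEven → ℕ → Ω → Bool) (N : ZEven → ℝ≥0 → Ω → ℕ)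
    (τ : ℝ≥0) (ω : Ω) : ℕ → ℤ :=
  pathFromOrigin (config η N τ ω)

end

end DyDW

open DyDW

/-!
At a fixed dynamical time the path from the origin is a simple random walk. At times `τ < τ'` the
two paths form a Markov chain: away from each other they move independently, and when they meet
they read the same arrow with probability `q = exp (-(τ' - τ))` and independent arrows otherwise.

Let `u m x` be the probability that a walk from `x` stays above the level and ends above the target
after `m` steps. The product `u m x * u m y` is carried exactly by the pair of walks, except for an
error `q * (∂u m x) ^ 2` each time the walks meet, where `∂u` is the spatial gradient. By the local
limit bound `(∂u m) ^ 2 ≤ 4 / (m + 1)`, and since `|x - y|` grows by `1 - q` at every meeting, the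
expected number of meetings in `n` steps is at most `2 √n / (1 - q)`. During the last `R` steps,
where the pointwise gradient bound is poor, the mean of `(∂u) ^ 2` along one walk is used instead:
it sums to order `√(R / n)`. With `D = τ' - τ` the total error is of order
`√n / (R D) + √(R / n)`, and the best `R` gives `(1 / (√n D)) ^ (1 / 3)`, where `n` is of order
`1 / δ²`.
-/

namespace DyDW

noncomputable section

/-! ### Killed transition operators -/

section KilledOp

variable {Q I : Type*} [Fintype I]

/-- The transition operator of the chain that moves from `w` to `T w i` with weight `c w i` and is
killed as soon as it leaves `G`. The weights need not sum to one. -/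
def killedOp (c : Q → I → ℝ) (T : Q → I → Q) (G : Set Q) : Module.End ℝ (Q → ℝ) where
  toFun f w := ∑ i, c w i * G.indicator f (T w i)
  map_add' f g := by
    ext w
    simp [Set.indicator_add', mul_add, Finset.sum_add_distrib]
  map_smul' a f := by
    ext w
    simp only [Pi.smul_apply, smul_eq_mul, RingHom.id_apply, Finset.mul_sum]
    refine Finset.sum_congr rfl fun i _ => ?_
    rw [mul_left_comm]
    exact congrArg _ (Set.indicator_const_smul_apply G a f (T w i))

variable {c : Q → I → ℝ} {T : Q → I → Q} {G : Set Q} {f g : Q → ℝ}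

theorem killedOp_apply (f : Q → ℝ) (w : Q) :
    killedOp c T G f w = ∑ i, c w i * G.indicator f (T w i) := rfl

theorem killedOp_congr (h : Set.EqOn f g G) : killedOp c T G f = killedOp c T G g := by
  ext w
  rw [killedOp_apply, killedOp_apply, Set.indicator_congr h]

theorem killedOp_mono (hc : ∀ w i, 0 ≤ c w i) (h : ∀ w ∈ G, f w ≤ g w) :
    killedOp c T G f ≤ killedOp c T G g := fun w =>
  Finset.sum_le_sum fun i _ => mul_le_mul_of_nonneg_left
    (Set.indicator_le_indicator' (h (T w i))) (hc w i)

theorem killedOp_le_killedOp_univ (hc : ∀ w i, 0 ≤ c w i) (hf : 0 ≤ f) :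
    killedOp c T G f ≤ killedOp c T Set.univ f := fun w =>
  Finset.sum_le_sum fun i _ => mul_le_mul_of_nonneg_left
    (Set.indicator_le_indicator_of_subset (Set.subset_univ G) hf (T w i)) (hc w i)

theorem killedOp_pow_mono (hc : ∀ w i, 0 ≤ c w i) (n : ℕ) (h : f ≤ g) :
    (killedOp c T G ^ n) f ≤ (killedOp c T G ^ n) g := by
  induction n with
  | zero => exact h
  | succ n ih =>
    rw [pow_succ', Module.End.mul_apply, Module.End.mul_apply]
    exact killedOp_mono hc fun w _ => ih w

theorem killedOp_pow_nonneg (hc : ∀ w i, 0 ≤ c w i) (n : ℕ) (hf : 0 ≤ f) :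
    0 ≤ (killedOp c T G ^ n) f := by
  simpa only [map_zero] using killedOp_pow_mono hc n hf

/-- Duhamel's principle for an approximate solution `f` of the killed evolution: the errors `g` made
along the way may be transported without killing. -/
theorem killedOp_pow_le_add_sum (hc : ∀ w i, 0 ≤ c w i) {f g : ℕ → Q → ℝ} (hg : ∀ m, 0 ≤ g m)
    (hfg : ∀ m, ∀ w ∈ G, killedOp c T G (f m) w ≤ f (m + 1) w + g m w) (n : ℕ) :
    ∀ w ∈ G, (killedOp c T G ^ n) (f 0) w ≤
      f n w + ∑ k ∈ Finset.range n, (killedOp c T Set.univ ^ k) (g (n - 1 - k)) w := by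
  set A := killedOp c T G
  set U := killedOp c T Set.univ
  induction n with
  | zero => simp
  | succ n ih =>
    intro w hw
    have transport_nonneg : 0 ≤ ∑ k ∈ Finset.range n, (U ^ k) (g (n - 1 - k)) :=
      Finset.sum_nonneg fun k _ => killedOp_pow_nonneg hc k (hg _)
    calc (A ^ (n + 1)) (f 0) w
        = A ((A ^ n) (f 0)) w := by rw [pow_succ', Module.End.mul_apply]
      _ ≤ A (f n + ∑ k ∈ Finset.range n, (U ^ k) (g (n - 1 - k))) w :=
        killedOp_mono hc (fun v hv => by simpa using ih v hv) w
      _ = A (f n) w + A (∑ k ∈ Finset.range n, (U ^ k) (g (n - 1 - k))) w := by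
        rw [map_add, Pi.add_apply]
      _ ≤ (f (n + 1) w + g n w) + U (∑ k ∈ Finset.range n, (U ^ k) (g (n - 1 - k))) w :=
        add_le_add (hfg n w hw) (killedOp_le_killedOp_univ hc transport_nonneg w)
      _ = f (n + 1) w + ∑ k ∈ Finset.range (n + 1), (U ^ k) (g (n + 1 - 1 - k)) w := by
        simp only [map_sum, Finset.sum_apply, Finset.sum_range_succ', pow_succ',
          Module.End.mul_apply, pow_zero, Module.End.one_apply, Nat.add_sub_cancel, Nat.sub_zero,
          Nat.sub_sub, Nat.add_comm 1]
        ring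

theorem add_sum_killedOp_pow_le (hc : ∀ w i, 0 ≤ c w i) (h : f + g ≤ killedOp c T G f) (n : ℕ) :
    f + ∑ k ∈ Finset.range n, (killedOp c T G ^ k) g ≤ (killedOp c T G ^ n) f := by
  induction n with
  | zero => simp
  | succ n ih =>
    calc f + ∑ k ∈ Finset.range (n + 1), (killedOp c T G ^ k) g
        = (f + ∑ k ∈ Finset.range n, (killedOp c T G ^ k) g) + (killedOp c T G ^ n) g := by
          rw [Finset.sum_range_succ, add_assoc]
      _ ≤ (killedOp c T G ^ n) f + (killedOp c T G ^ n) g := by gcongr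
      _ = (killedOp c T G ^ n) (f + g) := (map_add _ _ _).symm
      _ ≤ (killedOp c T G ^ n) (killedOp c T G f) := killedOp_pow_mono hc n h
      _ = (killedOp c T G ^ (n + 1)) f := by rw [pow_succ, Module.End.mul_apply]

end KilledOp

/-! ### Simple random walk -/

/-- Translation of functions on `ℤ` by `k`. -/
abbrev translate (k : ℤ) : Module.End ℝ (ℤ → ℝ) := LinearMap.funLeft ℝ ℝ (· + k)

theorem translate_mul_translate (k l : ℤ) : translate k * translate l = translate (k + l) := by
  ext f x
  simp [LinearMap.funLeft_apply, add_assoc]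

theorem translate_pow (k : ℤ) (n : ℕ) : translate k ^ n = translate (n * k) := by
  induction n with
  | zero => ext f x; simp [LinearMap.funLeft_apply]
  | succ n ih => rw [pow_succ, ih, translate_mul_translate]; push_cast; ring_nf

theorem commute_translate (k l : ℤ) : Commute (translate k) (translate l) := by
  rw [commute_iff_eq, translate_mul_translate, translate_mul_translate, add_comm]

/-- The transition operator of simple symmetric random walk killed outside `G`. -/
def walkOp (G : Set ℤ) : Module.End ℝ (ℤ → ℝ) :=
  killedOp (fun _ _ => 1 / 2) (fun (x : ℤ) (b : Bool) => x + incr b) G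

theorem walkOp_apply (G : Set ℤ) (f : ℤ → ℝ) (x : ℤ) :
    walkOp G f x = 1 / 2 * G.indicator f (x + 1) + 1 / 2 * G.indicator f (x - 1) := by
  simp [walkOp, killedOp_apply, incr, sub_eq_add_neg]

theorem walkOp_univ : walkOp Set.univ = (1 / 2 : ℝ) • (translate 1 + translate (-1)) := by
  ext f x
  simp [walkOp_apply, LinearMap.funLeft_apply, sub_eq_add_neg]

theorem walkOp_univ_pow_apply (n : ℕ) (f : ℤ → ℝ) (x : ℤ) :
    (walkOp Set.univ ^ n) f x =
      ∑ k ∈ Finset.range (n + 1), n.choose k / 2 ^ n * f (x + k - (n - k : ℕ)) := by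
  rw [walkOp_univ, smul_pow, (commute_translate 1 (-1)).add_pow]
  simp only [translate_pow, translate_mul_translate, LinearMap.smul_apply, LinearMap.sum_apply,
    Module.End.mul_apply, Pi.smul_apply, Finset.sum_apply, smul_eq_mul, Finset.mul_sum]
  refine Finset.sum_congr rfl fun k _ => ?_
  have natCast_smul : ((n.choose k : ℕ) : Module.End ℝ (ℤ → ℝ)) f = (n.choose k : ℝ) • f := by
    rw [Module.End.natCast_apply, Nat.cast_smul_eq_nsmul]
  rw [natCast_smul, map_smul, Pi.smul_apply, smul_eq_mul, LinearMap.funLeft_apply, one_div_pow,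
    ← mul_assoc, one_div_mul_eq_div]
  ring_nf

theorem centralBinom_sq_le (k : ℕ) : (2 * k + 1) * k.centralBinom ^ 2 ≤ 16 ^ k := by
  induction k with
  | zero => simp
  | succ k ih =>
    have scaled : (k + 1) ^ 2 * ((2 * (k + 1) + 1) * (k + 1).centralBinom ^ 2) ≤
        (k + 1) ^ 2 * 16 ^ (k + 1) := by
      calc (k + 1) ^ 2 * ((2 * (k + 1) + 1) * (k + 1).centralBinom ^ 2)
          = (2 * k + 3) * ((k + 1) * (k + 1).centralBinom) ^ 2 := by ring
        _ = 4 * ((2 * k + 3) * (2 * k + 1)) * ((2 * k + 1) * k.centralBinom ^ 2) := by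
          rw [Nat.succ_mul_centralBinom_succ]; ring
        _ ≤ 16 * (k + 1) ^ 2 * 16 ^ k := by
          gcongr ?_ * ?_
          nlinarith
        _ = (k + 1) ^ 2 * 16 ^ (k + 1) := by ring
    exact Nat.le_of_mul_le_mul_left scaled (by positivity)

theorem succ_mul_choose_half_sq_le (m : ℕ) : (m + 1) * m.choose (m / 2) ^ 2 ≤ 4 ^ m := by
  rcases Nat.even_or_odd' m with ⟨k, rfl | rfl⟩
  · have h := centralBinom_sq_le k
    rw [Nat.centralBinom_eq_two_mul_choose] at h
    rwa [show 2 * k / 2 = k by omega, pow_mul]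
  · have h := centralBinom_sq_le (k + 1)
    have centralBinom_succ : (k + 1).centralBinom = 2 * (2 * k + 1).choose k := by
      rw [Nat.centralBinom_eq_two_mul_choose, show 2 * (k + 1) = (2 * k + 1) + 1 by ring,
        Nat.choose_succ_succ, Nat.choose_symm_half]
      ring
    have pow_eq : 16 ^ (k + 1) = 4 * 4 ^ (2 * k + 1) := by
      rw [← pow_succ', show 16 = 4 ^ 2 by norm_num, ← pow_mul]; ring_nf
    rw [centralBinom_succ, pow_eq] at h
    rw [show (2 * k + 1) / 2 = k by omega]
    nlinarith

theorem choose_div_two_pow_le (m k : ℕ) : (m.choose k : ℝ) / 2 ^ m ≤ 1 / √(m + 1) := by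
  have middle : (m.choose k : ℝ) ≤ m.choose (m / 2) := by exact_mod_cast Nat.choose_le_middle k m
  have middle_sq : ((m : ℝ) + 1) * (m.choose (m / 2) : ℝ) ^ 2 ≤ (2 ^ m) ^ 2 := by
    rw [← pow_mul, mul_comm m 2, pow_mul]
    norm_num
    exact_mod_cast succ_mul_choose_half_sq_le m
  rw [div_le_div_iff₀ (by positivity) (by positivity), one_mul]
  calc (m.choose k : ℝ) * √(m + 1) ≤ m.choose (m / 2) * √(m + 1) := by gcongr
    _ ≤ 2 ^ m := by
      refine abs_le_of_sq_le_sq' ?_ (by positivity) |>.2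
      rwa [mul_pow, Real.sq_sqrt (by positivity), mul_comm]

theorem walkOp_univ_pow_single_le (m : ℕ) (x y : ℤ) :
    (walkOp Set.univ ^ m) (Pi.single y 1) x ≤ 1 / √(m + 1) := by
  simp only [walkOp_univ_pow_apply, Pi.single_apply, mul_ite, mul_one, mul_zero]
  by_cases reachable : ∃ k ∈ Finset.range (m + 1), x + (k : ℤ) - (m - k : ℕ) = y
  · obtain ⟨k, hk, rfl⟩ := reachable
    rw [Finset.sum_eq_single_of_mem k hk fun l hl hne => if_neg ?_, if_pos rfl]
    · exact choose_div_two_pow_le m k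
    · rw [Finset.mem_range] at hk hl
      omega
  · push Not at reachable
    rw [Finset.sum_eq_zero fun k hk => if_neg (reachable k hk)]
    positivity

/-! ### Survival above a level -/

section Survival

/-- The terminal payoff `1{c < x}`, extended antisymmetrically about the level `L`. -/
def payoff (L c x : ℤ) : ℝ := (if c < x then 1 else 0) - if c < 2 * L - x then 1 else 0

/-- The probability that simple random walk from a point above `L` stays above `L` and ends above
`c` after `m` steps, given by the reflection principle and extended antisymmetrically about `L`. -/
def survival (L c : ℤ) (m : ℕ) : ℤ → ℝ := (walkOp Set.univ ^ m) (payoff L c)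

/-- The central difference operator. -/
def centralDiff : Module.End ℝ (ℤ → ℝ) := (1 / 2 : ℝ) • (translate 1 - translate (-1))

/-- The spatial gradient of the survival probability. -/
def survivalGrad (L c : ℤ) (m : ℕ) : ℤ → ℝ := centralDiff (survival L c m)

variable {L c : ℤ}

theorem survival_succ (m : ℕ) (x : ℤ) :
    survival L c (m + 1) x = 1 / 2 * survival L c m (x + 1) + 1 / 2 * survival L c m (x - 1) := by
  simp [survival, pow_succ', walkOp_apply]

theorem survivalGrad_apply (m : ℕ) (x : ℤ) :
    survivalGrad L c m x = (survival L c m (x + 1) - survival L c m (x - 1)) / 2 := by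
  simp only [survivalGrad, centralDiff, LinearMap.smul_apply, LinearMap.sub_apply, Pi.smul_apply,
    Pi.sub_apply, LinearMap.funLeft_apply, smul_eq_mul, ← sub_eq_add_neg]
  ring

theorem survival_reflect (m : ℕ) (x : ℤ) : survival L c m (2 * L - x) = -survival L c m x := by
  induction m generalizing x with
  | zero => simp [survival, payoff]
  | succ m ih =>
    rw [survival_succ, survival_succ, show 2 * L - x + 1 = 2 * L - (x - 1) by ring,
      show 2 * L - x - 1 = 2 * L - (x + 1) by ring, ih, ih]
    ring

theorem survival_level (m : ℕ) : survival L c m L = 0 := by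
  have h := survival_reflect (L := L) (c := c) m L
  rw [show 2 * L - L = L by ring] at h
  linarith

theorem walkOp_Ioi_pow_survival (n m : ℕ) {x : ℤ} (hx : L < x) :
    (walkOp (Set.Ioi L) ^ n) (survival L c m) x = survival L c (m + n) x := by
  have killing_harmless (m : ℕ) {y : ℤ} (hy : L ≤ y) :
      (Set.Ioi L).indicator (survival L c m) y = survival L c m y := by
    rcases hy.eq_or_lt with rfl | hy
    · simp [survival_level]
    · exact Set.indicator_of_mem hy _
  induction n generalizing x with
  | zero => rfl
  | succ n ih =>
    have evolve : (walkOp (Set.Ioi L) ^ (n + 1)) (survival L c m) =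
        walkOp (Set.Ioi L) (survival L c (m + n)) := by
      rw [pow_succ', Module.End.mul_apply]
      exact killedOp_congr fun y hy => ih hy
    rw [evolve, walkOp_apply, killing_harmless _ (by omega), killing_harmless _ (by omega),
      ← add_assoc, survival_succ]

theorem payoff_of_lt (hc : L ≤ c) {x : ℤ} (hx : L < x) : payoff L c x = if c < x then 1 else 0 := by
  rw [payoff, if_neg (show ¬c < 2 * L - x by omega), sub_zero]

theorem centralDiff_payoff : centralDiff (payoff L c) =
    (1 / 2 : ℝ) • (Pi.single c 1 + Pi.single (c + 1) 1 +
      (Pi.single (2 * L - c) 1 + Pi.single (2 * L - c - 1) 1)) := by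
  have right_step (x : ℤ) : ((if c < x + 1 then 1 else 0) - if c < x + -1 then 1 else 0 : ℝ) =
      (if x = c then 1 else 0) + if x = c + 1 then 1 else 0 := by
    split_ifs <;> first | omega | norm_num
  have left_step (x : ℤ) :
      ((if c < 2 * L - (x + -1) then 1 else 0) - if c < 2 * L - (x + 1) then 1 else 0 : ℝ) =
      (if x = 2 * L - c then 1 else 0) + if x = 2 * L - c - 1 then 1 else 0 := by
    split_ifs <;> first | omega | norm_num
  ext x
  simp only [centralDiff, LinearMap.smul_apply, LinearMap.sub_apply, Pi.smul_apply, Pi.sub_apply,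
    Pi.add_apply, LinearMap.funLeft_apply, Pi.single_apply, payoff, ← right_step, ← left_step]
  ring_nf

theorem survivalGrad_eq (m : ℕ) :
    survivalGrad L c m = (walkOp Set.univ ^ m) (centralDiff (payoff L c)) := by
  have commute : Commute centralDiff (walkOp Set.univ) := by
    rw [walkOp_univ, centralDiff]
    refine .smul_left (.smul_right ?_ _) _
    exact .sub_left (.add_right (commute_translate ..) (commute_translate ..))
      (.add_right (commute_translate ..) (commute_translate ..))
  exact LinearMap.congr_fun (commute.pow_right m) (payoff L c)

theorem survivalGrad_nonneg (m : ℕ) : 0 ≤ survivalGrad L c m := by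
  rw [survivalGrad_eq, centralDiff_payoff]
  refine killedOp_pow_nonneg (by simp) m (smul_nonneg (by norm_num) ?_)
  have single_nonneg (y : ℤ) : (0 : ℤ → ℝ) ≤ Pi.single y 1 := Pi.single_nonneg.2 zero_le_one
  exact add_nonneg (add_nonneg (single_nonneg _) (single_nonneg _))
    (add_nonneg (single_nonneg _) (single_nonneg _))

theorem survivalGrad_le (m : ℕ) (x : ℤ) : survivalGrad L c m x ≤ 2 / √(m + 1) := by
  rw [survivalGrad_eq, centralDiff_payoff]
  simp only [map_smul, map_add, Pi.smul_apply, Pi.add_apply, smul_eq_mul]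
  have h (y : ℤ) := walkOp_univ_pow_single_le m x y
  calc _ ≤ 1 / 2 * (1 / √(m + 1) + 1 / √(m + 1) + (1 / √(m + 1) + 1 / √(m + 1))) := by
        gcongr <;> exact h _
    _ = 2 / √(m + 1) := by ring

theorem survivalGrad_sq_le (m : ℕ) (x : ℤ) : survivalGrad L c m x ^ 2 ≤ 4 / (m + 1) := by
  calc survivalGrad L c m x ^ 2
      ≤ (2 / √(m + 1)) ^ 2 := pow_le_pow_left₀ (survivalGrad_nonneg m x) (survivalGrad_le m x) 2
    _ = 4 / (m + 1) := by rw [div_pow, Real.sq_sqrt (by positivity)]; norm_num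

theorem walkOp_pow_survivalGrad_sq_le (n m : ℕ) (x : ℤ) :
    (walkOp Set.univ ^ n) (survivalGrad L c m ^ 2) x ≤ 4 / (√(m + 1) * √((n + m : ℕ) + 1)) := by
  have sq_le : survivalGrad L c m ^ 2 ≤ (2 / √(m + 1)) • survivalGrad L c m := fun y => by
    rw [Pi.pow_apply, sq]
    exact mul_le_mul_of_nonneg_right (survivalGrad_le m y) (survivalGrad_nonneg m y)
  calc (walkOp Set.univ ^ n) (survivalGrad L c m ^ 2) x
      ≤ (walkOp Set.univ ^ n) ((2 / √(m + 1)) • survivalGrad L c m) x :=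
        killedOp_pow_mono (by simp) n sq_le x
    _ = 2 / √(m + 1) * survivalGrad L c (n + m) x := by
        rw [map_smul, survivalGrad_eq, survivalGrad_eq, pow_add]
        rfl
    _ ≤ 2 / √(m + 1) * (2 / √((n + m : ℕ) + 1)) := by
        gcongr
        exact survivalGrad_le ..
    _ = 4 / (√(m + 1) * √((n + m : ℕ) + 1)) := by ring

end Survival

/-! ### The pair of walks -/

section PairOfWalks

/-- The joint law of the arrows read by two walks: independent fair arrows at different sites, and
at a common site the same fair arrow with probability `q` and independent ones otherwise. -/
def arrowWeight (q : ℝ) (same : Prop) [Decidable same] (i : Bool × Bool) : ℝ :=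
  if same then q * (if i.1 = i.2 then 1 / 2 else 0) + (1 - q) / 4 else 1 / 4

/-- The transition weights of the pair of walks. -/
def pairWeight (q : ℝ) (w : ℤ × ℤ) (i : Bool × Bool) : ℝ := arrowWeight q (w.1 = w.2) i

/-- The moves of the pair of walks. -/
def pairStep (w : ℤ × ℤ) (i : Bool × Bool) : ℤ × ℤ := (w.1 + incr i.1, w.2 + incr i.2)

/-- The transition operator of the pair of walks killed outside `G`. -/
abbrev pairOp (q : ℝ) (G : Set (ℤ × ℤ)) : Module.End ℝ (ℤ × ℤ → ℝ) :=
  killedOp (pairWeight q) pairStep G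

/-- The pairs of positions above the level `L`. -/
def above (L : ℤ) : Set (ℤ × ℤ) := {w | L < w.1 ∧ L < w.2}

/-- The indicator function of the diagonal, where the two walks meet. -/
def diag (w : ℤ × ℤ) : ℝ := if w.1 = w.2 then 1 else 0

/-- The product of the survival probabilities of the two walks. -/
def survivalProd (L c : ℤ) (m : ℕ) (w : ℤ × ℤ) : ℝ := survival L c m w.1 * survival L c m w.2

/-- The squared survival gradient on the diagonal, which measures the correlation created by one
common arrow. -/
def diagGrad (L c : ℤ) (m : ℕ) (w : ℤ × ℤ) : ℝ := diag w * survivalGrad L c m w.1 ^ 2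

variable {q : ℝ} {L c : ℤ}

theorem diag_nonneg : 0 ≤ diag := fun w => by
  rw [diag]
  split_ifs <;> simp

theorem diagGrad_nonneg (m : ℕ) : 0 ≤ diagGrad L c m := fun w =>
  mul_nonneg (diag_nonneg w) (sq_nonneg _)

theorem pairWeight_nonneg (hq : q ∈ Set.Icc 0 1) (w : ℤ × ℤ) (i : Bool × Bool) :
    0 ≤ pairWeight q w i := by
  have : 0 ≤ q := hq.1
  have : 0 ≤ 1 - q := sub_nonneg.2 hq.2
  unfold pairWeight arrowWeight
  positivity

theorem pairOp_univ_apply (f : ℤ × ℤ → ℝ) (x y : ℤ) : pairOp q Set.univ f (x, y) =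
    if x = y then q * ((f (x + 1, y + 1) + f (x - 1, y - 1)) / 2) + (1 - q) *
      ((f (x + 1, y + 1) + f (x + 1, y - 1) + f (x - 1, y + 1) + f (x - 1, y - 1)) / 4)
    else (f (x + 1, y + 1) + f (x + 1, y - 1) + f (x - 1, y + 1) + f (x - 1, y - 1)) / 4 := by
  simp only [killedOp_apply, pairWeight, arrowWeight, pairStep, Fintype.sum_prod_type,
    Fintype.sum_bool, Set.indicator_univ, incr, ← sub_eq_add_neg, if_true, Bool.false_eq_true,
    if_false, reduceCtorEq]
  split_ifs <;> ring

theorem pairOp_univ_pow_comp_fst (n : ℕ) (f : ℤ → ℝ) :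
    (pairOp q Set.univ ^ n) (f ∘ Prod.fst) = (walkOp Set.univ ^ n) f ∘ Prod.fst := by
  have one_step : pairOp q Set.univ ∘ₗ LinearMap.funLeft ℝ ℝ Prod.fst =
      LinearMap.funLeft ℝ ℝ Prod.fst ∘ₗ walkOp Set.univ := by
    ext f ⟨x, y⟩
    simp only [LinearMap.comp_apply, LinearMap.funLeft_apply, pairOp_univ_apply, walkOp_apply,
      Set.indicator_univ]
    split_ifs <;> ring
  exact LinearMap.congr_fun (Module.End.commute_pow_left_of_commute one_step n) f

/-! ### Meetings of the two walks -/

theorem abs_sub_add_diag_le_pairOp :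
    (fun w : ℤ × ℤ => |(w.1 : ℝ) - w.2|) + (1 - q) • diag ≤
      pairOp q Set.univ fun w => |(w.1 : ℝ) - w.2| := by
  rintro ⟨x, y⟩
  rw [pairOp_univ_apply, Pi.add_apply, Pi.smul_apply, smul_eq_mul, diag]
  push_cast
  split_ifs with h
  · subst h
    ring_nf
    norm_num
    linarith
  · have parallel_right : (x + 1 : ℝ) - (y + 1) = x - y := by ring
    have parallel_left : (x - 1 : ℝ) - (y - 1) = x - y := by ring
    have opposite := abs_add_le ((x + 1 : ℝ) - (y - 1)) (x - 1 - (y + 1))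
    rw [show (x + 1 : ℝ) - (y - 1) + (x - 1 - (y + 1)) = 2 * (x - y) by ring, abs_mul,
      abs_two] at opposite
    rw [parallel_right, parallel_left]
    linarith

theorem pairOp_univ_pow_sub_sq_add_le (hq : q ∈ Set.Icc 0 1) (a : ℝ) (n : ℕ) (w : ℤ × ℤ) :
    (pairOp q Set.univ ^ n) (fun w => ((w.1 : ℝ) - w.2) ^ 2 + a) w ≤
      ((w.1 : ℝ) - w.2) ^ 2 + a + 2 * n := by
  have := killedOp_pow_le_add_sum (G := Set.univ) (T := pairStep) (pairWeight_nonneg hq)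
    (f := fun m w => ((w.1 : ℝ) - w.2) ^ 2 + a + 2 * m) (g := 0) (fun _ => le_rfl) ?_ n w
    (Set.mem_univ w)
  · simpa using this
  · rintro m ⟨x, y⟩ -
    rw [pairOp_univ_apply]
    push_cast
    simp only [Pi.zero_apply]
    split_ifs with h
    · subst h
      ring_nf
      linarith [hq.1]
    · ring_nf
      rfl

theorem sum_pairOp_diag_le (hq : q ∈ Set.Icc 0 1) (n : ℕ) (x : ℤ) :
    (1 - q) * ∑ k ∈ Finset.range n, (pairOp q Set.univ ^ k) diag (x, x) ≤ 2 * √n := by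
  rcases Nat.eq_zero_or_pos n with rfl | hn
  · simp
  have : 0 < √(n : ℝ) := Real.sqrt_pos.2 (by exact_mod_cast hn)
  have sq_sqrt : √(n : ℝ) ^ 2 = n := Real.sq_sqrt n.cast_nonneg
  have abs_le_sq : (fun w : ℤ × ℤ => |(w.1 : ℝ) - w.2|) ≤
      (1 / (2 * √n)) • fun w : ℤ × ℤ => ((w.1 : ℝ) - w.2) ^ 2 + n := fun w => by
    rw [Pi.smul_apply, smul_eq_mul, one_div_mul_eq_div, le_div_iff₀ (by positivity)]
    nlinarith [sq_nonneg (|(w.1 : ℝ) - w.2| - √n), sq_abs ((w.1 : ℝ) - w.2)]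
  calc (1 - q) * ∑ k ∈ Finset.range n, (pairOp q Set.univ ^ k) diag (x, x)
      ≤ (pairOp q Set.univ ^ n) (fun w => |(w.1 : ℝ) - w.2|) (x, x) := by
        simpa [Finset.mul_sum] using
          add_sum_killedOp_pow_le (pairWeight_nonneg hq) abs_sub_add_diag_le_pairOp n (x, x)
    _ ≤ (pairOp q Set.univ ^ n)
          ((1 / (2 * √n)) • fun w : ℤ × ℤ => ((w.1 : ℝ) - w.2) ^ 2 + n) (x, x) :=
        killedOp_pow_mono (pairWeight_nonneg hq) n abs_le_sq (x, x)
    _ = 1 / (2 * √n) * (pairOp q Set.univ ^ n)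
          (fun w : ℤ × ℤ => ((w.1 : ℝ) - w.2) ^ 2 + n) (x, x) := by
        rw [map_smul, Pi.smul_apply, smul_eq_mul]
    _ ≤ 1 / (2 * √n) * (((x : ℝ) - x) ^ 2 + n + 2 * n) := by
        gcongr
        exact pairOp_univ_pow_sub_sq_add_le hq n n (x, x)
    _ ≤ 2 * √n := by
        rw [one_div_mul_eq_div, div_le_iff₀ (by positivity)]
        linarith

/-! ### Joint survival -/

theorem pairOp_above_survivalProd (m : ℕ) {w : ℤ × ℤ} (hw : w ∈ above L) :
    pairOp q (above L) (survivalProd L c m) w =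
      survivalProd L c (m + 1) w + q * diagGrad L c m w := by
  have step_le (x : ℤ) (b : Bool) (hx : L < x) : L ≤ x + incr b := by
    cases b <;> simp only [incr, if_true, Bool.false_eq_true, if_false] <;> omega
  have killing_harmless (i : Bool × Bool) :
      (above L).indicator (survivalProd L c m) (pairStep w i) =
        survivalProd L c m (pairStep w i) := by
    rw [Set.indicator_apply_eq_self, above, Set.mem_ofPred_eq, not_and_or, not_lt, not_lt]
    rintro (h | h)
    · rw [survivalProd, h.antisymm (step_le _ _ hw.1), survival_level, zero_mul]
    · rw [survivalProd, h.antisymm (step_le _ _ hw.2), survival_level, mul_zero]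
  have unkill : pairOp q (above L) (survivalProd L c m) w =
      pairOp q Set.univ (survivalProd L c m) w := by
    simp only [killedOp_apply, killing_harmless, Set.indicator_univ]
  obtain ⟨x, y⟩ := w
  rw [unkill, pairOp_univ_apply]
  simp only [survivalProd, diagGrad, diag, survival_succ, survivalGrad_apply]
  split_ifs with h
  · subst h; ring
  · ring

theorem pairOp_above_pow_survivalProd_le (hq : q ∈ Set.Icc 0 1) (n : ℕ) {x : ℤ} (hx : L < x) :
    (pairOp q (above L) ^ n) (survivalProd L c 0) (x, x) ≤ survival L c n x ^ 2 +
      q * ∑ k ∈ Finset.range n, (pairOp q Set.univ ^ k) (diagGrad L c (n - 1 - k)) (x, x) := by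
  have duhamel := killedOp_pow_le_add_sum (pairWeight_nonneg hq)
    (f := survivalProd L c) (g := fun m => q • diagGrad L c m)
    (fun m => smul_nonneg hq.1 (diagGrad_nonneg m))
    (fun m w hw => (pairOp_above_survivalProd m hw).le) n (x, x) ⟨hx, hx⟩
  simpa only [map_smul, Pi.smul_apply, smul_eq_mul, ← Finset.mul_sum, survivalProd, ← sq]
    using duhamel

theorem inv_sqrt_succ_le (j : ℕ) : 1 / √((j : ℝ) + 1) ≤ 2 * (√((j : ℝ) + 1) - √j) := by
  have hs : 0 < √((j : ℝ) + 1) := by positivity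
  have sq_succ : √((j : ℝ) + 1) ^ 2 = j + 1 := Real.sq_sqrt (by positivity)
  have sq_self : √(j : ℝ) ^ 2 = j := Real.sq_sqrt (by positivity)
  rw [div_le_iff₀ hs]
  nlinarith [sq_nonneg (√((j : ℝ) + 1) - √j)]

theorem pairOp_univ_pow_diagGrad_le (hq : q ∈ Set.Icc 0 1) (k m : ℕ) {R : ℝ} (hR : 0 < R) (x : ℤ) :
    (pairOp q Set.univ ^ k) (diagGrad L c m) (x, x) ≤
      4 / R * (pairOp q Set.univ ^ k) diag (x, x) +
        8 / √((k + m : ℕ) + 1) * (√(min (m + 1 : ℕ) R) - √(min m R)) := by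
  have hc := pairWeight_nonneg hq
  rcases le_or_gt ((m : ℝ) + 1) R with h | h
  · have diag_nonneg : 0 ≤ (pairOp q Set.univ ^ k) diag (x, x) :=
      killedOp_pow_nonneg hc k diag_nonneg (x, x)
    have diagGrad_le : diagGrad L c m ≤ (survivalGrad L c m ^ 2) ∘ Prod.fst := fun w => by
      simp only [diagGrad, diag, Function.comp_apply, Pi.pow_apply]
      split_ifs <;> nlinarith [sq_nonneg (survivalGrad L c m w.1)]
    calc (pairOp q Set.univ ^ k) (diagGrad L c m) (x, x)
        ≤ (pairOp q Set.univ ^ k) ((survivalGrad L c m ^ 2) ∘ Prod.fst) (x, x) :=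
          killedOp_pow_mono hc k diagGrad_le (x, x)
      _ = (walkOp Set.univ ^ k) (survivalGrad L c m ^ 2) x := by
          rw [pairOp_univ_pow_comp_fst, Function.comp_apply]
      _ ≤ 4 / √((k + m : ℕ) + 1) * (1 / √(m + 1)) :=
          (walkOp_pow_survivalGrad_sq_le k m x).trans_eq (by field_simp)
      _ ≤ 4 / √((k + m : ℕ) + 1) * (2 * (√(m + 1) - √m)) := by
          gcongr
          exact inv_sqrt_succ_le m
      _ = 8 / √((k + m : ℕ) + 1) * (√(min (m + 1 : ℕ) R) - √(min m R)) := by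
          rw [min_eq_left (by exact_mod_cast h), min_eq_left (by linarith)]
          push_cast
          ring
      _ ≤ _ := le_add_of_nonneg_left (by positivity)
  · have diagGrad_le : diagGrad L c m ≤ (4 / R) • diag := fun w => by
      rw [diagGrad, Pi.smul_apply, smul_eq_mul, mul_comm]
      gcongr
      · exact diag_nonneg w
      · exact (survivalGrad_sq_le m w.1).trans (by gcongr)
    calc (pairOp q Set.univ ^ k) (diagGrad L c m) (x, x)
        ≤ 4 / R * (pairOp q Set.univ ^ k) diag (x, x) := by
          simpa only [map_smul, Pi.smul_apply, smul_eq_mul] using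
            killedOp_pow_mono hc k diagGrad_le (x, x)
      _ ≤ _ := by
          refine le_add_of_nonneg_right (mul_nonneg (by positivity) (sub_nonneg.2 ?_))
          gcongr
          simp

theorem sum_pairOp_diagGrad_le (hq : q ∈ Set.Icc 0 1) {R : ℝ} (hR : 0 < R) (n : ℕ) (x : ℤ) :
    ∑ k ∈ Finset.range n, (pairOp q Set.univ ^ k) (diagGrad L c (n - 1 - k)) (x, x) ≤
      4 / R * ∑ k ∈ Finset.range n, (pairOp q Set.univ ^ k) diag (x, x) + 8 / √n * √R := by
  have telescope : ∑ k ∈ Finset.range n, (√(min ((n - 1 - k : ℕ) + 1 : ℕ) R) -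
      √(min ((n - 1 - k : ℕ) : ℝ) R)) = √(min n R) := by
    rw [Finset.sum_range_reflect (fun m : ℕ => √(min ((m + 1 : ℕ) : ℝ) R) - √(min (m : ℝ) R)),
      Finset.sum_range_sub fun m : ℕ => √(min (m : ℝ) R)]
    simp [hR.le]
  calc ∑ k ∈ Finset.range n, (pairOp q Set.univ ^ k) (diagGrad L c (n - 1 - k)) (x, x)
      ≤ ∑ k ∈ Finset.range n, (4 / R * (pairOp q Set.univ ^ k) diag (x, x) +
          8 / √n * (√(min ((n - 1 - k : ℕ) + 1 : ℕ) R) - √(min ((n - 1 - k : ℕ) : ℝ) R))) := by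
        refine Finset.sum_le_sum fun k hk => ?_
        have time_eq : ((k + (n - 1 - k) : ℕ) : ℝ) + 1 = n := by
          have := Finset.mem_range.1 hk
          exact_mod_cast (by omega : k + (n - 1 - k) + 1 = n)
        simpa only [time_eq] using pairOp_univ_pow_diagGrad_le hq k (n - 1 - k) hR x
    _ = 4 / R * ∑ k ∈ Finset.range n, (pairOp q Set.univ ^ k) diag (x, x) +
          8 / √n * √(min n R) := by
        rw [Finset.sum_add_distrib, ← Finset.mul_sum, ← Finset.mul_sum, telescope]
    _ ≤ _ := by
        gcongr
        exact min_le_right _ _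

theorem pairOp_above_pow_survivalProd_le_of_pos (hq : q ∈ Set.Icc 0 1) {D : ℝ} (hD : 0 < D)
    (hqD : q * D ≤ 1 - q) {R : ℝ} (hR : 0 < R) (n : ℕ) {x : ℤ} (hx : L < x) :
    (pairOp q (above L) ^ n) (survivalProd L c 0) (x, x) ≤
      survival L c n x ^ 2 + 8 * (√n / (R * D) + √R / √n) := by
  set meetings := ∑ k ∈ Finset.range n, (pairOp q Set.univ ^ k) diag (x, x)
  have meetings_nonneg : 0 ≤ meetings := Finset.sum_nonneg fun k _ =>
    killedOp_pow_nonneg (pairWeight_nonneg hq) k diag_nonneg (x, x)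
  have meetings_le : q * meetings ≤ 2 * √n / D := by
    rw [le_div_iff₀ hD, mul_right_comm]
    exact (mul_le_mul_of_nonneg_right hqD meetings_nonneg).trans (sum_pairOp_diag_le hq n x)
  refine (pairOp_above_pow_survivalProd_le hq n hx).trans (add_le_add le_rfl ?_)
  calc q * ∑ k ∈ Finset.range n, (pairOp q Set.univ ^ k) (diagGrad L c (n - 1 - k)) (x, x)
      ≤ q * (4 / R * meetings + 8 / √n * √R) :=
        mul_le_mul_of_nonneg_left (sum_pairOp_diagGrad_le hq hR n x) hq.1
    _ = 4 / R * (q * meetings) + q * (8 / √n * √R) := by ring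
    _ ≤ 4 / R * (2 * √n / D) + 1 * (8 / √n * √R) := by
        gcongr
        exact hq.2
    _ = 8 * (√n / (R * D) + √R / √n) := by field_simp; ring

theorem pairOp_above_pow_survivalProd_le_rpow (hq : q ∈ Set.Icc 0 1) {D : ℝ} (hD : 0 < D)
    (hqD : q * D ≤ 1 - q) {n : ℕ} (hn : 0 < n) {x : ℤ} (hx : L < x) :
    (pairOp q (above L) ^ n) (survivalProd L c 0) (x, x) ≤
      survival L c n x ^ 2 + 16 * (1 / (√n * D)) ^ (1 / 3 : ℝ) := by
  have hs : 0 < √(n : ℝ) := by positivity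
  have sq_sqrt : √(n : ℝ) ^ 2 = n := Real.sq_sqrt n.cast_nonneg
  obtain ⟨t, ht⟩ : ∃ t, t = (1 / (√n * D)) ^ (1 / 3 : ℝ) := ⟨_, rfl⟩
  have t_pos : 0 < t := by rw [ht]; positivity
  have t_cubed : t ^ 3 * (√n * D) = 1 := by
    rw [ht, ← Real.rpow_natCast, ← Real.rpow_mul (by positivity)]
    norm_num
    field_simp
  -- the choice of `R` that balances the two error terms
  have bound := pairOp_above_pow_survivalProd_le_of_pos (c := c) hq hD hqD
    (R := t ^ 2 * n) (by positivity) n hx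
  have first_term : √n / (t ^ 2 * n * D) = t := by
    rw [div_eq_iff (by positivity)]
    linear_combination (-√n) * t_cubed + t ^ 3 * D * sq_sqrt
  have second_term : √(t ^ 2 * n) / √n = t := by
    rw [Real.sqrt_mul (by positivity), Real.sqrt_sq t_pos.le, mul_div_cancel_right₀ _ hs.ne']
  rw [first_term, second_term] at bound
  rw [← ht]
  linarith

end PairOfWalks

/-! ### Chains driven by random input -/

section DrivenChain

variable {Ω Q I : Type*}

/-- The event that the process `X` stays in `G` up to time `n`. -/
def alive (X : ℕ → Ω → Q) (G : Set Q) (n : ℕ) : Set Ω := {ω | ∀ k ≤ n, X k ω ∈ G}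

theorem alive_succ (X : ℕ → Ω → Q) (G : Set Q) (n : ℕ) :
    alive X G (n + 1) = alive X G n ∩ X (n + 1) ⁻¹' G := by
  ext ω
  simp only [alive, Nat.le_succ_iff, Set.mem_ofPred_eq, Set.mem_inter_iff, Set.mem_preimage]
  exact ⟨fun h => ⟨fun k hk => h k (.inl hk), h _ (.inr rfl)⟩,
    fun h k hk => hk.elim (h.1 k) fun hk => hk ▸ h.2⟩

/-- The σ-algebra of the past of the process `X` up to and including time `n`; the state space is
discrete. -/
@[reducible]
def pastSigma (X : ℕ → Ω → Q) (n : ℕ) : MeasurableSpace Ω :=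
  ⨆ k ≤ n, MeasurableSpace.comap (X k) ⊤

theorem measurableSet_pastSigma (X : ℕ → Ω → Q) {k n : ℕ} (hk : k ≤ n) (G : Set Q) :
    MeasurableSet[pastSigma X n] (X k ⁻¹' G) :=
  le_iSup₂ (f := fun k (_ : k ≤ n) => MeasurableSpace.comap (X k) ⊤) k hk _ ⟨G, trivial, rfl⟩

theorem measurableSet_pastSigma_alive (X : ℕ → Ω → Q) (G : Set Q) (n : ℕ) :
    MeasurableSet[pastSigma X n] (alive X G n) := by
  have alive_eq : alive X G n = ⋂ k, ⋂ _ : k ≤ n, X k ⁻¹' G := by ext; simp [alive]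
  rw [alive_eq]
  exact .iInter fun k => .iInter fun hk => measurableSet_pastSigma X hk G

theorem pastSigma_le_iff {X : ℕ → Ω → Q} {n : ℕ} {m : MeasurableSpace Ω} :
    pastSigma X n ≤ m ↔ ∀ k ≤ n, ∀ G, MeasurableSet[m] (X k ⁻¹' G) := by
  refine iSup₂_le_iff.trans (forall₂_congr fun k _ => ⟨fun h G => h _ ⟨G, trivial, rfl⟩, ?_⟩)
  rintro h _ ⟨G, -, rfl⟩
  exact h G

variable [MeasurableSpace Ω] {P : Measure Ω}

/-- The chain `X` starts at `w₀` and moves from `w` to `T w i` on reading the input `i`; given its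
past, the chain in state `w` reads the input `i` with conditional probability `c w i`. -/
structure IsDrivenChain (P : Measure Ω) (X : ℕ → Ω → Q) (Y : ℕ → Ω → I) (c : Q → I → ℝ)
    (T : Q → I → Q) (w₀ : Q) : Prop where
  measurableSet_input : ∀ n i, MeasurableSet (Y n ⁻¹' {i})
  start : ∀ ω, X 0 ω = w₀
  step : ∀ n ω, X (n + 1) ω = T (X n ω) (Y n ω)
  condLaw : ∀ n w i A, MeasurableSet[pastSigma X n] A → A ⊆ X n ⁻¹' {w} →
    P.real (A ∩ Y n ⁻¹' {i}) = P.real A * c w i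

theorem setIntegral_comp_eq_sum [IsFiniteMeasure P] {ι : Type*} {Z : Ω → ι}
    (hZ : ∀ x, MeasurableSet (Z ⁻¹' {x})) {R : Finset ι} (hR : ∀ ω, Z ω ∈ R) (A : Set Ω)
    (f : ι → ℝ) : ∫ ω in A, f (Z ω) ∂P = ∑ x ∈ R, P.real (A ∩ Z ⁻¹' {x}) * f x := by
  classical
  have split_fibers (ω : Ω) : f (Z ω) = ∑ x ∈ R, (Z ⁻¹' {x}).indicator (fun _ => f x) ω := by
    simp [Set.indicator_apply, hR ω]
  simp only [split_fibers]
  rw [integral_finsetSum _ fun x _ => (integrable_const _).indicator (hZ x)]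
  refine Finset.sum_congr rfl fun x _ => ?_
  rw [setIntegral_indicator (hZ x), setIntegral_const, smul_eq_mul]

namespace IsDrivenChain

variable {X : ℕ → Ω → Q} {Y : ℕ → Ω → I} {c : Q → I → ℝ} {T : Q → I → Q} {w₀ : Q} {G : Set Q}

theorem measurableSet_preimage [Countable I] (h : IsDrivenChain P X Y c T w₀) (n : ℕ)
    (G : Set Q) : MeasurableSet (X n ⁻¹' G) := by
  induction n generalizing G with
  | zero => simp [Set.preimage, h.start]
  | succ n ih =>
    have split_input : X (n + 1) ⁻¹' G = ⋃ i, Y n ⁻¹' {i} ∩ X n ⁻¹' {w | T w i ∈ G} := by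
      ext ω
      simp [h.step]
    rw [split_input]
    exact .iUnion fun i => (h.measurableSet_input n i).inter (ih _)

theorem measurableSet_alive [Countable I] (h : IsDrivenChain P X Y c T w₀) (G : Set Q) (n : ℕ) :
    MeasurableSet (alive X G n) :=
  pastSigma_le_iff.2 (fun k _ => h.measurableSet_preimage k) _ (measurableSet_pastSigma_alive X G n)

theorem exists_finset_forall_mem [Finite I] (h : IsDrivenChain P X Y c T w₀) (n : ℕ) :
    ∃ R : Finset Q, ∀ ω, X n ω ∈ R := by
  classical
  cases nonempty_fintype I
  induction n with
  | zero => exact ⟨{w₀}, by simp [h.start]⟩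
  | succ n ih =>
    obtain ⟨R, hR⟩ := ih
    refine ⟨(R ×ˢ Finset.univ).image fun p => T p.1 p.2, fun ω => ?_⟩
    rw [h.step]
    exact Finset.mem_image.2 ⟨(X n ω, Y n ω), by simp [hR ω], rfl⟩

variable [Fintype I] [IsProbabilityMeasure P]

theorem setIntegral_alive_succ (h : IsDrivenChain P X Y c T w₀) (n : ℕ) (f : Q → ℝ) :
    ∫ ω in alive X G (n + 1), f (X (n + 1) ω) ∂P =
      ∫ ω in alive X G n, killedOp c T G f (X n ω) ∂P := by
  obtain ⟨R, hR⟩ := h.exists_finset_forall_mem n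
  have state_measurable (w : Q) : MeasurableSet (X n ⁻¹' {w}) := h.measurableSet_preimage n {w}
  have fiber (w : Q) (i : I) : alive X G n ∩ (fun ω => (X n ω, Y n ω)) ⁻¹' {(w, i)} =
      alive X G n ∩ X n ⁻¹' {w} ∩ Y n ⁻¹' {i} := by
    ext ω
    simp [and_assoc]
  have pair_measurable (p : Q × I) : MeasurableSet ((fun ω => (X n ω, Y n ω)) ⁻¹' {p}) := by
    rw [← Set.singleton_prod_singleton, Set.mk_preimage_prod]
    exact (state_measurable p.1).inter (h.measurableSet_input n p.2)
  have markov (w : Q) (i : I) : P.real (alive X G n ∩ X n ⁻¹' {w} ∩ Y n ⁻¹' {i}) =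
      P.real (alive X G n ∩ X n ⁻¹' {w}) * c w i :=
    h.condLaw n w i _ ((measurableSet_pastSigma_alive X G n).inter
      (measurableSet_pastSigma X le_rfl {w})) Set.inter_subset_right
  calc ∫ ω in alive X G (n + 1), f (X (n + 1) ω) ∂P
      = ∫ ω in alive X G n, G.indicator f (T (X n ω) (Y n ω)) ∂P := by
        rw [alive_succ, ← setIntegral_indicator (h.measurableSet_preimage (n + 1) G)]
        simp only [← h.step]
        rfl
    _ = ∑ p ∈ R ×ˢ Finset.univ, P.real (alive X G n ∩ (fun ω => (X n ω, Y n ω)) ⁻¹' {p}) *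
          G.indicator f (T p.1 p.2) :=
        setIntegral_comp_eq_sum pair_measurable (fun ω => by simp [hR ω]) _
          fun p => G.indicator f (T p.1 p.2)
    _ = ∑ w ∈ R, P.real (alive X G n ∩ X n ⁻¹' {w}) * killedOp c T G f w := by
        simp only [Finset.sum_product, fiber, markov, killedOp_apply, Finset.mul_sum, mul_assoc]
    _ = ∫ ω in alive X G n, killedOp c T G f (X n ω) ∂P :=
        (setIntegral_comp_eq_sum state_measurable hR _ _).symm

theorem setIntegral_alive_eq (h : IsDrivenChain P X Y c T w₀) (hw₀ : w₀ ∈ G) (n : ℕ) (f : Q → ℝ) :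
    ∫ ω in alive X G n, f (X n ω) ∂P = (killedOp c T G ^ n) f w₀ := by
  induction n generalizing f with
  | zero =>
    have alive_zero : alive X G 0 = Set.univ := Set.eq_univ_of_forall fun ω k hk => by
      rwa [Nat.le_zero.1 hk, h.start]
    simp [alive_zero, h.start]
  | succ n ih => rw [h.setIntegral_alive_succ, ih, pow_succ, Module.End.mul_apply]

theorem measureReal_alive_inter (h : IsDrivenChain P X Y c T w₀) (hw₀ : w₀ ∈ G) (n : ℕ)
    {f : Q → ℝ} {B : Set Q} (hf : Set.EqOn f (B.indicator 1) G) :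
    P.real (alive X G n ∩ X n ⁻¹' B) = (killedOp c T G ^ n) f w₀ := by
  rw [← h.setIntegral_alive_eq hw₀ n f, setIntegral_congr_fun (h.measurableSet_alive G n)
    fun ω hω => hf (hω n le_rfl), ← setIntegral_one_eq_measureReal,
    ← setIntegral_indicator (h.measurableSet_preimage n B)]
  rfl

end IsDrivenChain

theorem measureReal_inter_of_indep {m₁ m₂ : MeasurableSpace Ω} (h : Indep m₁ m₂ P) {s t : Set Ω}
    (hs : MeasurableSet[m₁] s) (ht : MeasurableSet[m₂] t) :
    P.real (s ∩ t) = P.real s * P.real t := by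
  simp only [measureReal_def, ← ENNReal.toReal_mul, (Indep_iff m₁ m₂ P).1 h s t hs ht]

theorem isDrivenChain_of_iIndepFun [MeasurableSpace I] [DiscreteMeasurableSpace I] [Countable I]
    {X : ℕ → Ω → Q} {Y : ℕ → Ω → I} {p : I → ℝ} {T : Q → I → Q} {w₀ : Q}
    (measurable_input : ∀ n, Measurable (Y n)) (indep : iIndepFun Y P)
    (law : ∀ n i, P.real (Y n ⁻¹' {i}) = p i) (start : ∀ ω, X 0 ω = w₀)
    (step : ∀ n ω, X (n + 1) ω = T (X n ω) (Y n ω)) :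
    IsDrivenChain P X Y (fun _ => p) T w₀ where
  measurableSet_input n i := measurable_input n .of_discrete
  start := start
  step := step
  condLaw n w i A hA _ := by
    have past_le : pastSigma X n ≤ ⨆ k ∈ Set.Iio n, MeasurableSpace.comap (Y k) inferInstance := by
      rw [pastSigma_le_iff]
      intro k
      induction k with
      | zero => intro _ G; simp [Set.preimage, start]
      | succ k ih =>
        intro hk G
        have split_input : X (k + 1) ⁻¹' G = ⋃ i, Y k ⁻¹' {i} ∩ X k ⁻¹' {w | T w i ∈ G} := by
          ext ω
          simp [step]
        rw [split_input]
        refine .iUnion fun i => .inter ?_ (ih (by omega) _)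
        exact le_iSup₂ (f := fun k (_ : k ∈ Set.Iio n) => MeasurableSpace.comap (Y k) inferInstance)
          k hk _ ⟨{i}, .of_discrete, rfl⟩
    have indep_past : Indep (pastSigma X n) (MeasurableSpace.comap (Y n) inferInstance) P := by
      have h := indep_iSup_of_disjoint (fun k => (measurable_input k).comap_le) indep
        (S := Set.Iio n) (T := {n}) (by simp)
      rw [iSup_singleton] at h
      exact indep_of_indep_of_le_left h past_le
    rw [measureReal_inter_of_indep indep_past hA ⟨{i}, .of_discrete, rfl⟩, law]

end DrivenChain

/-! ### Survival of simple random walk -/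

section SimpleWalk

variable {Ω : Type*} [MeasurableSpace Ω] {P : Measure Ω}

theorem measureReal_bool_eq_half [IsProbabilityMeasure P] {Y : Ω → Bool} (hY : Measurable Y)
    (h : P {ω | Y ω = true} = 1 / 2) (b : Bool) : P.real (Y ⁻¹' {b}) = 1 / 2 := by
  have prob_true : P.real (Y ⁻¹' {true}) = 1 / 2 := by
    rw [measureReal_def]
    exact (congrArg ENNReal.toReal h).trans (by simp)
  cases b
  · have compl_true : Y ⁻¹' {false} = (Y ⁻¹' {true})ᶜ := by ext ω; simp
    rw [compl_true, probReal_compl_eq_one_sub (hY (measurableSet_singleton true)), prob_true]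
    norm_num
  · exact prob_true

namespace IsSimpleSymmetricWalk

variable {S : ℕ → Ω → ℤ}

theorem measurable_sub (hS : IsSimpleSymmetricWalk P S) (n : ℕ) :
    Measurable fun ω => S (n + 1) ω - S n ω :=
  (hS.measurable (n + 1)).sub (hS.measurable n)

variable [IsProbabilityMeasure P]

theorem ae_eq_add_incr (hS : IsSimpleSymmetricWalk P S) (n : ℕ) :
    ∀ᵐ ω ∂P, S (n + 1) ω = S n ω + incr (decide (S (n + 1) ω - S n ω = 1)) := by
  have disjoint : Disjoint {ω | S (n + 1) ω - S n ω = 1} {ω | S (n + 1) ω - S n ω = -1} :=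
    Set.disjoint_left.2 fun _ (h₁ : _ = _) (h₂ : _ = _) => by omega
  have right_measurable := hS.measurable_sub n (measurableSet_singleton 1)
  have left_measurable := hS.measurable_sub n (measurableSet_singleton (-1))
  have full : P ({ω | S (n + 1) ω - S n ω = 1} ∪ {ω | S (n + 1) ω - S n ω = -1}) = 1 := by
    rw [measure_union disjoint left_measurable, hS.incr_right, hS.incr_left, ENNReal.add_halves]
  have unit_step := (mem_ae_iff_prob_eq_one (right_measurable.union left_measurable)).2 full
  filter_upwards [unit_step] with ω hω
  rcases hω with (h : S (n + 1) ω - S n ω = 1) | (h : S (n + 1) ω - S n ω = -1)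
  · rw [h, decide_eq_true rfl, incr, if_pos rfl, ← h, add_sub_cancel]
  · rw [h, decide_eq_false (by decide), incr, if_neg Bool.false_ne_true, ← h, add_sub_cancel]

/-- The sums of the signs of the increments agree with `S` almost surely, and start at `0` and move
by unit steps surely. -/
theorem exists_isDrivenChain (hS : IsSimpleSymmetricWalk P S) :
    ∃ (X : ℕ → Ω → ℤ) (Y : ℕ → Ω → Bool), (∀ᵐ ω ∂P, ∀ n, S n ω = X n ω) ∧
      IsDrivenChain P X Y (fun _ _ => 1 / 2) (fun x b => x + incr b) 0 := by
  have sign_measurable (n : ℕ) : Measurable fun ω => decide (S (n + 1) ω - S n ω = 1) :=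
    (measurable_of_countable fun d : ℤ => decide (d = 1)).comp (hS.measurable_sub n)
  refine ⟨fun n ω => ∑ k ∈ Finset.range n, incr (decide (S (k + 1) ω - S k ω = 1)),
    fun n ω => decide (S (n + 1) ω - S n ω = 1), ?_,
    isDrivenChain_of_iIndepFun sign_measurable
      (hS.indep.comp (fun _ d => decide (d = 1)) fun _ => measurable_of_countable _)
      (fun n b => measureReal_bool_eq_half (sign_measurable n) (by simpa using hS.incr_right n) b)
      (fun _ => by simp) (fun n _ => Finset.sum_range_succ _ _)⟩
  filter_upwards [hS.start, ae_all_iff.2 hS.ae_eq_add_incr] with ω start step n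
  induction n with
  | zero => simpa using start
  | succ n ih => rw [step n, Finset.sum_range_succ, ih]

theorem measureReal_survival (hS : IsSimpleSymmetricWalk P S) {L c : ℤ} (hL : L < 0) (hc : L ≤ c)
    (M : ℕ) : P.real {ω | (∀ k ≤ M, L < S k ω) ∧ c < S M ω} = survival L c M 0 := by
  obtain ⟨X, Y, S_eq, chain⟩ := hS.exists_isDrivenChain
  have payoff_eq : Set.EqOn (survival L c 0) ((Set.Ioi c).indicator 1) (Set.Ioi L) :=
    fun x hx => (payoff_of_lt hc hx).trans (by rw [Set.indicator_apply]; rfl)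
  calc P.real {ω | (∀ k ≤ M, L < S k ω) ∧ c < S M ω}
      = P.real (alive X (Set.Ioi L) M ∩ X M ⁻¹' Set.Ioi c) := by
        refine measureReal_congr ?_
        filter_upwards [S_eq] with ω hω
        refine propext ?_
        change ((∀ k ≤ M, L < S k ω) ∧ c < S M ω) ↔ ((∀ k ≤ M, L < X k ω) ∧ c < X M ω)
        simp only [hω]
    _ = (walkOp (Set.Ioi L) ^ M) (survival L c 0) 0 := chain.measureReal_alive_inter hL M payoff_eq
    _ = survival L c M 0 := by rw [walkOp_Ioi_pow_survival M 0 hL, zero_add]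

end IsSimpleSymmetricWalk

end SimpleWalk

/-! ### The input read by the paths of the web -/

section Web

theorem follow_succ (A : ZEven → Bool) (z : ZEven) (n : ℕ) :
    follow A z (n + 1) = step (follow A z n) (A (follow A z n)) :=
  Function.iterate_succ_apply' ..

theorem follow_origin_coe (A : ZEven → Bool) (n : ℕ) :
    (follow A origin n : ℤ × ℤ) = (pathFromOrigin A n, (n : ℤ)) := by
  refine Prod.ext rfl ?_
  induction n with
  | zero => rfl
  | succ n ih => simpa [follow_succ, step] using ih

theorem follow_origin_inj {A B : ZEven → Bool} {n : ℕ} :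
    follow A origin n = follow B origin n ↔ pathFromOrigin A n = pathFromOrigin B n := by
  simp [Subtype.ext_iff, follow_origin_coe]

/-- The arrow of `A` that the path from the origin reads at time `n`. -/
def readArrow (A : ZEven → Bool) (n : ℕ) : Bool := A (follow A origin n)

theorem pathFromOrigin_succ (A : ZEven → Bool) (n : ℕ) :
    pathFromOrigin A (n + 1) = pathFromOrigin A n + incr (readArrow A n) := by
  rw [pathFromOrigin, follow_succ]
  rfl

variable {Ω : Type*} {η : ZEven → ℕ → Ω → Bool} {N : ZEven → ℝ≥0 → Ω → ℕ}

/-- The σ-algebras of the single arrows and of the single clocks. -/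
@[reducible]
def inputSigma (η : ZEven → ℕ → Ω → Bool) (N : ZEven → ℝ≥0 → Ω → ℕ) :
    (ZEven × ℕ) ⊕ ZEven → MeasurableSpace Ω :=
  Sum.elim (fun p => MeasurableSpace.comap (η p.1 p.2) inferInstance)
    (fun z => MeasurableSpace.comap (fun ω t => N z t ω) inferInstance)

/-- The site to which an arrow or a clock belongs. -/
def inputSite : (ZEven × ℕ) ⊕ ZEven → ZEven := Sum.elim Prod.fst id

/-- The σ-algebra generated by all arrows and clocks at the sites in `A`. -/
@[reducible]
def siteSigma (η : ZEven → ℕ → Ω → Bool) (N : ZEven → ℝ≥0 → Ω → ℕ) (A : Set ZEven) :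
    MeasurableSpace Ω :=
  ⨆ i ∈ inputSite ⁻¹' A, inputSigma η N i

theorem measurable_arrow_siteSigma {A : Set ZEven} {z : ZEven} (hz : z ∈ A) (n : ℕ) :
    Measurable[siteSigma η N A] (η z n) :=
  (comap_measurable (η z n)).mono (le_iSup₂_of_le (f := fun i _ => inputSigma η N i)
    (Sum.inl (z, n)) hz le_rfl) le_rfl

theorem measurable_clock_siteSigma {A : Set ZEven} {z : ZEven} (hz : z ∈ A) (t : ℝ≥0) :
    Measurable[siteSigma η N A] (N z t) :=
  have clock_measurable : Measurable[siteSigma η N A] fun ω t => N z t ω :=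
    (comap_measurable fun ω t => N z t ω).mono (le_iSup₂_of_le (f := fun i _ => inputSigma η N i)
      (Sum.inr z) hz le_rfl) le_rfl
  (measurable_pi_apply t).comp clock_measurable

theorem measurable_config_siteSigma {A : Set ZEven} {z : ZEven} (hz : z ∈ A) (τ : ℝ≥0) :
    Measurable[siteSigma η N A] fun ω => config η N τ ω z := by
  let _ := siteSigma η N A
  have arrow_measurable : Measurable fun p : Ω × ℕ => η z p.2 p.1 :=
    measurable_from_prod_countable_left fun n => measurable_arrow_siteSigma hz n
  exact arrow_measurable.comp (measurable_id.prodMk (measurable_clock_siteSigma hz τ))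

theorem measurableSet_config_siteSigma {A : Set ZEven} {z : ZEven} (hz : z ∈ A) (τ : ℝ≥0)
    (b : Bool) : MeasurableSet[siteSigma η N A] {ω | config η N τ ω z = b} :=
  measurable_config_siteSigma hz τ (measurableSet_singleton b)

/-- The sites before time `n`. -/
def sitesBefore (n : ℕ) : Set ZEven := {z | z.1.2 < n}

theorem measurable_follow_siteSigma (τ : ℝ≥0) {k n : ℕ} (hk : k ≤ n) :
    Measurable[siteSigma η N (sitesBefore n)] fun ω => follow (config η N τ ω) origin k := by
  induction k with
  | zero => exact measurable_const
  | succ k ih =>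
    refine @measurable_to_countable' _ _ _ _ (siteSigma η N (sitesBefore n)) _ fun w => ?_
    have split_site : (fun ω => follow (config η N τ ω) origin (k + 1)) ⁻¹' {w} =
        ⋃ z ∈ sitesBefore n, (fun ω => follow (config η N τ ω) origin k) ⁻¹' {z} ∩
          (fun ω => step z (config η N τ ω z)) ⁻¹' {w} := by
      ext ω
      have site_before : follow (config η N τ ω) origin k ∈ sitesBefore n := by
        rw [sitesBefore, Set.mem_ofPred_eq, follow_origin_coe]
        exact Int.ofNat_lt.2 hk
      simp only [Set.mem_preimage, Set.mem_singleton_iff, follow_succ, Set.mem_iUnion,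
        Set.mem_inter_iff]
      exact ⟨fun h => ⟨_, site_before, rfl, h⟩, fun ⟨_, _, hz, h⟩ => hz ▸ h⟩
    rw [split_site]
    refine .biUnion (Set.to_countable _) fun z hz => ?_
    exact (ih (by omega) (measurableSet_singleton z)).inter <|
      (measurable_of_countable (step z)).comp (measurable_config_siteSigma hz τ)
        (measurableSet_singleton w)

theorem measurable_walk_siteSigma (τ : ℝ≥0) {k n : ℕ} (hk : k ≤ n) :
    Measurable[siteSigma η N (sitesBefore n)] fun ω => walk η N τ ω k :=
  (measurable_of_countable fun z : ZEven => z.1.1).comp (measurable_follow_siteSigma τ hk)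

end Web

theorem measureReal_iUnion_of_disjoint {Ω ι : Type*} [MeasurableSpace Ω] {P : Measure Ω}
    [IsFiniteMeasure P] [Countable ι] {s : ι → Set Ω} (hd : Pairwise (Function.onFun Disjoint s))
    (hs : ∀ i, MeasurableSet (s i)) : P.real (⋃ i, s i) = ∑' i, P.real (s i) := by
  rw [measureReal_def, measure_iUnion hd hs, ENNReal.tsum_toReal_eq fun i => measure_ne_top P _]
  rfl

theorem measureReal_random_index {Ω ι : Type*} [MeasurableSpace Ω] {P : Measure Ω}
    [IsFiniteMeasure P] [Countable ι] {X : Ω → ι} (hX : ∀ x, MeasurableSet (X ⁻¹' {x}))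
    {E : ι → Set Ω} (hE : ∀ x, MeasurableSet (E x)) (B : Set ι) {c : ℝ}
    (h : ∀ x ∈ B, P.real (X ⁻¹' {x} ∩ E x) = P.real (X ⁻¹' {x}) * c) :
    P.real {ω | X ω ∈ B ∧ ω ∈ E (X ω)} = P.real (X ⁻¹' B) * c := by
  have disjoint : Pairwise (Function.onFun Disjoint fun x : B => X ⁻¹' {x.1}) :=
    fun x y hxy => (Set.disjoint_singleton.2 (Subtype.coe_ne_coe.2 hxy)).preimage X
  have split_event : {ω | X ω ∈ B ∧ ω ∈ E (X ω)} = ⋃ x : B, X ⁻¹' {x.1} ∩ E x := by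
    ext ω
    simp
  have split_index : X ⁻¹' B = ⋃ x : B, X ⁻¹' {x.1} := by
    ext ω
    simp
  rw [split_event, split_index, measureReal_iUnion_of_disjoint
      (fun x y hxy => (disjoint hxy).mono Set.inter_subset_left Set.inter_subset_left)
      fun x => (hX x).inter (hE x),
    measureReal_iUnion_of_disjoint disjoint fun x => hX x, ← tsum_mul_right]
  exact tsum_congr fun x => h x x.2

/-! ### The joint law of two walks of the dynamics -/

namespace IsDynamics

variable {Ω : Type*} [mΩ : MeasurableSpace Ω] {P : Measure Ω}
  {η : ZEven → ℕ → Ω → Bool} {N : ZEven → ℝ≥0 → Ω → ℕ}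

theorem inputSigma_le (h : IsDynamics P η N) : ∀ i, inputSigma η N i ≤ mΩ
  | .inl p => (h.measurable_arrow p.1 p.2).comap_le
  | .inr z => (measurable_pi_lambda _ fun t => (h.clock z).measurable t).comap_le

theorem siteSigma_le (h : IsDynamics P η N) (A : Set ZEven) : siteSigma η N A ≤ mΩ :=
  iSup₂_le fun i _ => h.inputSigma_le i

theorem measurable_config (h : IsDynamics P η N) (τ : ℝ≥0) (z : ZEven) :
    Measurable fun ω => config η N τ ω z :=
  (measurable_config_siteSigma (Set.mem_univ z) τ).mono (h.siteSigma_le _) le_rfl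

theorem measurable_readArrow (h : IsDynamics P η N) (τ : ℝ≥0) (n : ℕ) :
    Measurable fun ω => readArrow (config η N τ ω) n :=
  have config_measurable : Measurable fun p : Ω × ZEven => config η N τ p.1 p.2 :=
    measurable_from_prod_countable_left (h.measurable_config τ)
  config_measurable.comp (measurable_id.prodMk
    ((measurable_follow_siteSigma τ le_rfl).mono (h.siteSigma_le _) le_rfl))

theorem iIndep_inputSigma (h : IsDynamics P η N) : iIndep (inputSigma η N) P := by
  rw [iIndep_iff]
  intro s f hf
  have split_inputs : ⋂ i ∈ s, f i =
      (⋂ p ∈ s.toLeft, f (Sum.inl p)) ∩ ⋂ z ∈ s.toRight, f (Sum.inr z) := by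
    ext ω
    simp
  have arrow_mem (p) (hp : p ∈ s.toLeft) := hf _ (Finset.mem_toLeft.1 hp)
  have clock_mem (z) (hz : z ∈ s.toRight) := hf _ (Finset.mem_toRight.1 hz)
  have arrow_le (p : ZEven × ℕ) : inputSigma η N (.inl p) ≤
      MeasurableSpace.comap (fun ω (p : ZEven × ℕ) => η p.1 p.2 ω) inferInstance :=
    fun _ ⟨u, hu, e⟩ =>
      ⟨Function.eval p ⁻¹' u, measurable_pi_apply p hu, e⟩
  have clock_le (z : ZEven) : inputSigma η N (.inr z) ≤
      MeasurableSpace.comap (fun ω (z : ZEven) (t : ℝ≥0) => N z t ω) inferInstance :=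
    fun _ ⟨u, hu, e⟩ =>
      ⟨Function.eval z ⁻¹' u, measurable_pi_apply z hu, e⟩
  rw [split_inputs, (Indep_iff _ _ _).1 h.indep_arrows_clocks _ _
      (Finset.measurableSet_biInter _ fun p hp => arrow_le p _ (arrow_mem p hp))
      (Finset.measurableSet_biInter _ fun z hz => clock_le z _ (clock_mem z hz)),
    (iIndep_iff _ _).1 h.indep_arrows s.toLeft arrow_mem,
    (iIndep_iff _ _).1 h.indep_clocks s.toRight clock_mem,
    Finset.prod_sum_eq_prod_toLeft_mul_prod_toRight]

theorem indep_siteSigma (h : IsDynamics P η N) {A B : Set ZEven} (hAB : Disjoint A B) :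
    Indep (siteSigma η N A) (siteSigma η N B) P :=
  indep_iSup_of_disjoint h.inputSigma_le h.iIndep_inputSigma (hAB.preimage _)

theorem measureReal_clock_inter_arrow (h : IsDynamics P η N) (z : ZEven)
    {s : Set (ℝ≥0 → ℕ)} {t : Set (ℕ → Bool)} (hs : MeasurableSet s) (ht : MeasurableSet t) :
    P.real ((fun ω u => N z u ω) ⁻¹' s ∩ (fun ω n => η z n ω) ⁻¹' t) =
      P.real ((fun ω u => N z u ω) ⁻¹' s) * P.real ((fun ω n => η z n ω) ⁻¹' t) :=
  measureReal_inter_of_indep h.indep_arrows_clocks.symm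
    ⟨(fun f => f z) ⁻¹' s, measurable_pi_apply z hs, rfl⟩
    ⟨(fun f n => f (z, n)) ⁻¹' t,
      (measurable_pi_lambda _ fun n => measurable_pi_apply (z, n)) ht, rfl⟩

theorem measureReal_no_ring (h : IsDynamics P η N) (z : ZEven) {τ τ' : ℝ≥0} (hτ : τ ≤ τ') :
    P.real {ω | N z τ ω = N z τ' ω} = Real.exp (-((τ' : ℝ) - τ)) := by
  have increment_measurable : Measurable fun ω => N z τ' ω - N z τ ω :=
    ((h.clock z).measurable τ').sub ((h.clock z).measurable τ)
  have increment_zero : P.real {ω | N z τ' ω - N z τ ω = 0} = Real.exp (-((τ' : ℝ) - τ)) := by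
    have poisson_zero := poissonMeasure_real_singleton (τ' - τ) 0
    rw [← (h.clock z).law τ τ' hτ,
      map_measureReal_apply increment_measurable (measurableSet_singleton 0)] at poisson_zero
    exact poisson_zero.trans (by simp [NNReal.coe_sub hτ])
  rw [← increment_zero]
  refine measureReal_congr ?_
  filter_upwards [(h.clock z).mono] with ω hω
  have ring_le : N z τ ω ≤ N z τ' ω := hω hτ
  refine propext ?_
  change N z τ ω = N z τ' ω ↔ N z τ' ω - N z τ ω = 0
  omega

variable [IsProbabilityMeasure P]

theorem measureReal_arrow (h : IsDynamics P η N) (z : ZEven) (n : ℕ) (b : Bool) :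
    P.real {ω | η z n ω = b} = 1 / 2 :=
  measureReal_bool_eq_half (h.measurable_arrow z n) (h.fair z n) b

theorem measureReal_arrow_pair (h : IsDynamics P η N) (z : ZEven) {j k : ℕ} (hjk : j ≠ k)
    (a b : Bool) : P.real {ω | η z j ω = a ∧ η z k ω = b} = 1 / 4 := by
  have arrows_indep := h.indep_arrows.indepFun (i := (z, j)) (j := (z, k)) (by simpa using hjk)
  have product := measureReal_inter_of_indep arrows_indep (s := {ω | η z j ω = a})
    (t := {ω | η z k ω = b}) ⟨{a}, .of_discrete, rfl⟩ ⟨{b}, .of_discrete, rfl⟩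
  rw [h.measureReal_arrow, h.measureReal_arrow] at product
  exact product.trans (by norm_num)

theorem measureReal_clock_mem_and_config (h : IsDynamics P η N) (z : ZEven) (τ τ' : ℝ≥0)
    (B : Set (ℕ × ℕ)) (a b : Bool) {c : ℝ}
    (hc : ∀ p ∈ B, P.real {ω | η z p.1 ω = a ∧ η z p.2 ω = b} = c) :
    P.real {ω | (N z τ ω, N z τ' ω) ∈ B ∧ config η N τ ω z = a ∧ config η N τ' ω z = b} =
      P.real {ω | (N z τ ω, N z τ' ω) ∈ B} * c := by
  have clocks_measurable : Measurable fun ω => (N z τ ω, N z τ' ω) :=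
    ((h.clock z).measurable τ).prodMk ((h.clock z).measurable τ')
  have clock_event (p : ℕ × ℕ) : MeasurableSet {f : ℝ≥0 → ℕ | (f τ, f τ') = p} :=
    measurableSet_eq_fun ((measurable_pi_apply τ).prodMk (measurable_pi_apply τ')) measurable_const
  have arrow_event (p : ℕ × ℕ) : MeasurableSet {g : ℕ → Bool | g p.1 = a ∧ g p.2 = b} :=
    (measurableSet_eq_fun (measurable_pi_apply _) measurable_const).inter
      (measurableSet_eq_fun (measurable_pi_apply _) measurable_const)
  refine measureReal_random_index (X := fun ω => (N z τ ω, N z τ' ω))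
    (E := fun p => {ω | η z p.1 ω = a ∧ η z p.2 ω = b})
    (fun p => clocks_measurable (measurableSet_singleton p))
    (fun p => (h.measurable_arrow z p.1 (measurableSet_singleton a)).inter
      (h.measurable_arrow z p.2 (measurableSet_singleton b))) B fun p hp => ?_
  rw [← hc p hp]
  exact h.measureReal_clock_inter_arrow z (clock_event p) (arrow_event p)

theorem measureReal_arrow_diag (h : IsDynamics P η N) (z : ZEven) (n : ℕ) (a b : Bool) :
    P.real {ω | η z n ω = a ∧ η z n ω = b} = if a = b then 1 / 2 else 0 := by
  split_ifs with hab
  · simpa only [hab, and_self] using h.measureReal_arrow z n b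
  · have empty : {ω | η z n ω = a ∧ η z n ω = b} = ∅ :=
      Set.eq_empty_of_forall_notMem fun ω hω => hab (hω.1.symm.trans hω.2)
    rw [empty, measureReal_empty]

theorem measureReal_config (h : IsDynamics P η N) (z : ZEven) (τ : ℝ≥0) (b : Bool) :
    P.real {ω | config η N τ ω z = b} = 1 / 2 := by
  simpa using h.measureReal_clock_mem_and_config z τ τ {p | p.1 = p.2} b b (c := 1 / 2)
    fun p (hp : p.1 = p.2) => by rw [hp, h.measureReal_arrow_diag, if_pos rfl]

theorem measureReal_config_same (h : IsDynamics P η N) (z : ZEven) {τ τ' : ℝ≥0} (hτ : τ ≤ τ')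
    (a b : Bool) : P.real {ω | config η N τ ω z = a ∧ config η N τ' ω z = b} =
      Real.exp (-((τ' : ℝ) - τ)) * (if a = b then 1 / 2 else 0) +
        (1 - Real.exp (-((τ' : ℝ) - τ))) / 4 := by
  have no_ring_measurable : MeasurableSet {ω | N z τ ω = N z τ' ω} :=
    measurableSet_eq_fun ((h.clock z).measurable τ) ((h.clock z).measurable τ')
  have no_ring := h.measureReal_clock_mem_and_config z τ τ' {p | p.1 = p.2} a b
    fun p (hp : p.1 = p.2) => by rw [hp, h.measureReal_arrow_diag]
  have ring := h.measureReal_clock_mem_and_config z τ τ' {p | p.1 = p.2}ᶜ a b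
    fun p (hp : p.1 ≠ p.2) => h.measureReal_arrow_pair z hp a b
  have ring_prob : P.real {ω | N z τ ω = N z τ' ω}ᶜ = 1 - Real.exp (-((τ' : ℝ) - τ)) := by
    rw [probReal_compl_eq_one_sub no_ring_measurable, h.measureReal_no_ring z hτ]
  rw [← measureReal_inter_add_sdiff no_ring_measurable, Set.inter_comm, Set.sdiff_eq,
    Set.inter_comm _ {ω | N z τ ω = N z τ' ω}ᶜ, ← h.measureReal_no_ring z hτ]
  refine congrArg₂ (· + ·) no_ring (ring.trans ?_)
  rw [h.measureReal_no_ring z hτ, ← ring_prob, mul_one_div]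
  rfl

theorem measureReal_config_pair (h : IsDynamics P η N) (z z' : ZEven) {τ τ' : ℝ≥0} (hτ : τ ≤ τ')
    (i : Bool × Bool) : P.real {ω | config η N τ ω z = i.1 ∧ config η N τ' ω z' = i.2} =
      arrowWeight (Real.exp (-((τ' : ℝ) - τ))) (z = z') i := by
  unfold arrowWeight
  by_cases hz : z = z'
  · rw [if_pos hz, ← hz, h.measureReal_config_same z hτ]
  · rw [if_neg hz, Set.ofPred_and, measureReal_inter_of_indep
        (h.indep_siteSigma (A := {z}) (B := {z'}) (Set.disjoint_singleton.2 hz))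
        (measurableSet_config_siteSigma (Set.mem_singleton z) τ i.1)
        (measurableSet_config_siteSigma (Set.mem_singleton z') τ' i.2),
      h.measureReal_config, h.measureReal_config]
    norm_num

/-- Given the past, the sites visited at time `n` are determined by the positions of the two walks,
and their arrows are independent of the past. -/
theorem measureReal_inter_readArrow (h : IsDynamics P η N) {τ τ' : ℝ≥0} (hτ : τ ≤ τ') (n : ℕ)
    (w : ℤ × ℤ) (i : Bool × Bool) {A : Set Ω}
    (hA : MeasurableSet[siteSigma η N (sitesBefore n)] A)
    (hAw : ∀ ω ∈ A, (walk η N τ ω n, walk η N τ' ω n) = w) :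
    P.real (A ∩ {ω | (readArrow (config η N τ ω) n, readArrow (config η N τ' ω) n) = i}) =
      P.real A * pairWeight (Real.exp (-((τ' : ℝ) - τ))) w i := by
  rcases A.eq_empty_or_nonempty with rfl | ⟨ω₀, hω₀⟩
  · simp
  obtain rfl := hAw ω₀ hω₀
  set z := follow (config η N τ ω₀) origin n with hz
  set z' := follow (config η N τ' ω₀) origin n with hz'
  have visit_z (ω) (hω : ω ∈ A) : follow (config η N τ ω) origin n = z :=
    follow_origin_inj.2 (Prod.mk.inj (hAw ω hω)).1
  have visit_z' (ω) (hω : ω ∈ A) : follow (config η N τ' ω) origin n = z' :=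
    follow_origin_inj.2 (Prod.mk.inj (hAw ω hω)).2
  have read_at : A ∩ {ω | (readArrow (config η N τ ω) n, readArrow (config η N τ' ω) n) = i} =
      A ∩ {ω | config η N τ ω z = i.1 ∧ config η N τ' ω z' = i.2} := by
    ext ω
    refine and_congr_right fun hω => ?_
    simp only [Set.mem_ofPred_eq, readArrow, visit_z ω hω, visit_z' ω hω, Prod.ext_iff]
  have disjoint : Disjoint (sitesBefore n) {z, z'} := by
    refine Set.disjoint_left.2 fun y (hy : y.1.2 < n) hy' => ?_
    rcases hy' with rfl | rfl <;> simp [hz, hz', follow_origin_coe] at hy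
  rw [read_at, Set.ofPred_and, measureReal_inter_of_indep (h.indep_siteSigma disjoint) hA
      ((measurableSet_config_siteSigma (.inl rfl) τ i.1).inter
        (measurableSet_config_siteSigma (.inr rfl) τ' i.2))]
  exact congrArg _ <|
    (h.measureReal_config_pair z z' hτ i).trans (if_congr follow_origin_inj rfl rfl)

theorem isDrivenChain (h : IsDynamics P η N) {τ τ' : ℝ≥0} (hτ : τ ≤ τ') :
    IsDrivenChain P (fun n ω => (walk η N τ ω n, walk η N τ' ω n))
      (fun n ω => (readArrow (config η N τ ω) n, readArrow (config η N τ' ω) n))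
      (pairWeight (Real.exp (-((τ' : ℝ) - τ)))) pairStep (0, 0) where
  measurableSet_input n i :=
    ((h.measurable_readArrow τ n).prodMk (h.measurable_readArrow τ' n)) (measurableSet_singleton i)
  start _ := rfl
  step n ω := Prod.ext (pathFromOrigin_succ _ n) (pathFromOrigin_succ _ n)
  condLaw n w i _ hA hAw := by
    have past_le : pastSigma (fun n ω => (walk η N τ ω n, walk η N τ' ω n)) n ≤
        siteSigma η N (sitesBefore n) :=
      pastSigma_le_iff.2 fun k hk _ =>
        (measurable_walk_siteSigma τ hk).prodMk (measurable_walk_siteSigma τ' hk) .of_discrete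
    exact h.measureReal_inter_readArrow hτ n w i (past_le _ hA) fun ω hω => hAw hω

theorem measureReal_survival_pair (h : IsDynamics P η N) {τ τ' : ℝ≥0} (hτ : τ ≤ τ') {L c : ℤ}
    (hL : L < 0) (hc : L ≤ c) (M : ℕ) :
    P.real {ω | ((∀ k ≤ M, L < walk η N τ ω k) ∧ c < walk η N τ ω M) ∧
        (∀ k ≤ M, L < walk η N τ' ω k) ∧ c < walk η N τ' ω M} =
      (pairOp (Real.exp (-((τ' : ℝ) - τ))) (above L) ^ M) (survivalProd L c 0) (0, 0) := by
  have payoff_eq : Set.EqOn (survivalProd L c 0) ((above c).indicator 1) (above L) := by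
    rintro w ⟨h₁, h₂⟩
    change payoff L c w.1 * payoff L c w.2 = _
    rw [payoff_of_lt hc h₁, payoff_of_lt hc h₂]
    by_cases h₁ : c < w.1 <;> by_cases h₂ : c < w.2 <;> simp [above, h₁, h₂]
  rw [← (h.isDrivenChain hτ).measureReal_alive_inter (G := above L) ⟨hL, hL⟩ M payoff_eq]
  congr 1
  ext ω
  change (_ ∧ _) ∧ _ ∧ _ ↔ (∀ k ≤ M, _ ∧ _) ∧ _ ∧ _
  simp only [forall_and, and_and_and_comm]

end IsDynamics

/-! ### The event `O` at integer times -/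

section Event

/-- Nearest neighbour paths started at `0`. -/
def IsNearestNeighbor (s : ℕ → ℤ) : Prop := s 0 = 0 ∧ ∀ n, ∃ b, s (n + 1) = s n + incr b

theorem isNearestNeighbor_pathFromOrigin (A : ZEven → Bool) :
    IsNearestNeighbor (pathFromOrigin A) :=
  ⟨rfl, fun n => ⟨_, pathFromOrigin_succ A n⟩⟩

theorem IsSimpleSymmetricWalk.ae_isNearestNeighbor {Ω : Type*} [MeasurableSpace Ω] {P : Measure Ω}
    [IsProbabilityMeasure P] {S : ℕ → Ω → ℤ} (hS : IsSimpleSymmetricWalk P S) :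
    ∀ᵐ ω ∂P, IsNearestNeighbor fun n => S n ω := by
  filter_upwards [hS.start, ae_all_iff.2 hS.ae_eq_add_incr] with ω start step
  exact ⟨start, fun n => ⟨_, step n⟩⟩

namespace IsNearestNeighbor

variable {s : ℕ → ℤ}

theorem succ_eq_or (hs : IsNearestNeighbor s) (n : ℕ) :
    s (n + 1) = s n + 1 ∨ s (n + 1) = s n - 1 := by
  obtain ⟨b, hb⟩ := hs.2 n
  cases b
  · exact .inr hb
  · exact .inl hb

theorem even (hs : IsNearestNeighbor s) (n : ℕ) : Even (s n + n) := by
  induction n with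
  | zero => simp [hs.1]
  | succ n ih =>
    rcases hs.succ_eq_or n with h | h <;> rw [h] <;> push_cast <;> grind

theorem le_natCast (hs : IsNearestNeighbor s) (n : ℕ) : s n ≤ n := by
  induction n with
  | zero => simp [hs.1]
  | succ n ih =>
    push_cast
    rcases hs.succ_eq_or n with h | h <;> omega

theorem interp_le (hs : IsNearestNeighbor s) (t : ℝ≥0) : interp s t ≤ t := by
  have floor_le : (⌊t⌋₊ : ℝ) ≤ t := Nat.floor_le t.2
  have path_le : (s ⌊t⌋₊ : ℝ) ≤ ⌊t⌋₊ := by exact_mod_cast hs.le_natCast _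
  have increment_le : (s (⌊t⌋₊ + 1) : ℝ) - s ⌊t⌋₊ ≤ 1 := by
    rcases hs.succ_eq_or ⌊t⌋₊ with h | h <;> rw [h] <;> push_cast <;> linarith
  have := mul_le_of_le_one_right (sub_nonneg.2 floor_le) increment_le
  rw [interp]
  linarith

end IsNearestNeighbor

theorem interp_natCast (s : ℕ → ℤ) (n : ℕ) : interp s n = s n := by
  simp [interp_eq_of_mem s n n ⟨le_rfl, le_self_add⟩]

theorem lt_add_mul_of_le {a x d u v : ℝ} (hu : 0 ≤ u) (huv : u ≤ v) (hx : a < x)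
    (hv : a < x + v * d) : a < x + u * d := by
  rcases le_total 0 d with hd | hd
  · have := mul_nonneg hu hd
    linarith
  · have := mul_le_mul_of_nonpos_right huv hd
    linarith

theorem forall_lt_interp_iff {s : ℕ → ℤ} {a : ℝ} {T : ℝ≥0} :
    (∀ t ≤ T, a < interp s t) ↔ (∀ k ≤ ⌊T⌋₊, a < s k) ∧ a < interp s T := by
  refine ⟨fun h => ⟨fun k hk => ?_, h T le_rfl⟩, fun ⟨h, hT⟩ t ht => ?_⟩
  · rw [← interp_natCast]
    exact h k ((Nat.le_floor_iff T.2).1 hk)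
  · have floor_le : (0 : ℝ) ≤ t - ⌊t⌋₊ := sub_nonneg.2 (Nat.floor_le t.2)
    have above_floor := h _ (Nat.floor_le_floor ht)
    rcases (Nat.floor_le_floor ht).lt_or_eq with floor_lt | floor_eq
    · have le_one : (t : ℝ) - ⌊t⌋₊ ≤ 1 := by
        have : (t : ℝ) < ⌊t⌋₊ + 1 := Nat.lt_floor_add_one t
        linarith
      exact lt_add_mul_of_le floor_le le_one above_floor (by simpa using h _ floor_lt)
    · refine lt_add_mul_of_le floor_le (sub_le_sub_right (NNReal.coe_le_coe.2 ht) _) above_floor ?_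
      rwa [interp, ← floor_eq] at hT

theorem rescale_mem_O_iff {δ : ℝ≥0} (hδ : 0 < δ) {s : ℕ → ℤ} : rescale δ (toPath s) ∈ O ↔
    (∀ t ≤ 1 / δ ^ 2, -(1 / (δ : ℝ)) < interp s t) ∧ 1 / (δ : ℝ) < interp s (1 / δ ^ 2) := by
  have hδ' : (0 : ℝ) < δ := hδ
  have neg_one_lt (x : ℝ) : -1 < x * δ ↔ -(1 / (δ : ℝ)) < x := by
    rw [← div_lt_iff₀ hδ', neg_div]
  have one_lt (x : ℝ) : 1 < x * δ ↔ 1 / (δ : ℝ) < x := (div_lt_iff₀ hδ').symm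
  have unscale : rescale δ (toPath s) ∈ O ↔
      (∀ t : unitInterval, -(1 / (δ : ℝ)) < interp s (unitInterval.toNNReal t / δ ^ 2)) ∧
        1 / (δ : ℝ) < interp s (unitInterval.toNNReal 1 / δ ^ 2) :=
    and_congr (forall_congr' fun t => neg_one_lt _) (one_lt _)
  rw [unscale]
  refine and_congr ⟨fun h t ht => ?_, fun h t => h _ ?_⟩ Iff.rfl
  · have mem : (t * δ ^ 2 : ℝ) ∈ unitInterval :=
      ⟨by positivity, by exact_mod_cast (le_div_iff₀ (by positivity)).1 ht⟩
    have eq : unitInterval.toNNReal ⟨_, mem⟩ / δ ^ 2 = t := by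
      rw [div_eq_iff (by positivity)]
      rfl
    exact eq ▸ h ⟨_, mem⟩
  · gcongr
    exact t.2.2

theorem notMem_O_of_one_le {δ : ℝ≥0} (hδ : 1 ≤ δ) {s : ℕ → ℤ} (hs : IsNearestNeighbor s) :
    rescale δ (toPath s) ∉ O := by
  intro h
  have above_one := ((rescale_mem_O_iff (one_pos.trans_le hδ)).1 h).2.trans_le (hs.interp_le _)
  have pow_le : (1 / δ ^ 2 : ℝ≥0) ≤ 1 / δ := by
    gcongr
    exact le_self_pow₀ hδ two_ne_zero
  exact above_one.not_ge (by exact_mod_cast pow_le)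

theorem exists_even_threshold (r : ℝ) (n : ℕ) :
    ∃ y : ℤ, Even (y + n) ∧ ∀ x : ℤ, Even (x + n) → (r < x ↔ y ≤ x) := by
  rcases Int.even_or_odd (⌊r⌋ + 1 + n) with even | odd
  · exact ⟨⌊r⌋ + 1, even, fun x _ => by rw [← Int.floor_lt, Int.add_one_le_iff]⟩
  · refine ⟨⌊r⌋ + 2, by grind, fun x hx => ?_⟩
    rw [← Int.floor_lt]
    grind

theorem IsNearestNeighbor.lt_add_mul_iff {s : ℕ → ℤ} (hs : IsNearestNeighbor s) (b θ : ℝ) (n : ℕ) :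
    s (n + 1) = s n + 1 ∧ (b < s n + θ * (s (n + 1) - s n) ↔ b - θ < s n) ∨
      s (n + 1) = s n - 1 ∧ (b < s n + θ * (s (n + 1) - s n) ↔ b + θ < s n) := by
  refine (hs.succ_eq_or n).imp (fun h => ⟨h, ?_⟩) fun h => ⟨h, ?_⟩ <;>
  · rw [h]
    push_cast
    constructor <;> intro <;> linarith

-- `s n` has the parity of `n`, so that one of the two neighbouring integer times decides.
theorem exists_integer_threshold {b θ : ℝ} (hθ : 0 ≤ θ) (hθ1 : θ ≤ 1) (hb : θ ≤ b) (N : ℕ) :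
    ∃ M c, (M = N ∨ M = N + 1) ∧ (0 : ℤ) ≤ c ∧ ∀ s, IsNearestNeighbor s →
      (b < s N + θ * (s (N + 1) - s N) ↔ c < s M) := by
  obtain ⟨y, y_even, lt_iff⟩ := exists_even_threshold (b - θ) N
  have lt_y : b - θ < y := (lt_iff y y_even).2 le_rfl
  have y_pos : 0 < y := by exact_mod_cast (sub_nonneg.2 hb).trans_lt lt_y
  rcases lt_or_ge (b + θ) y with y_large | y_small
  · refine ⟨N, y - 1, .inl rfl, by omega, fun s hs => ?_⟩
    rw [Int.sub_one_lt_iff]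
    rcases hs.lt_add_mul_iff b θ N with ⟨-, right⟩ | ⟨-, left⟩
    · rw [right, lt_iff _ (hs.even N)]
    · rw [left]
      exact ⟨fun h => (lt_iff _ (hs.even N)).1 (by linarith),
        fun h => y_large.trans_le (by exact_mod_cast h)⟩
  · refine ⟨N + 1, y, .inr rfl, y_pos.le, fun s hs => ?_⟩
    rcases hs.lt_add_mul_iff b θ N with ⟨up, right⟩ | ⟨down, left⟩
    · rw [right, lt_iff _ (hs.even N), up, Int.lt_add_one_iff]
    · have lt_iff_add_two_le : y < s N - 1 ↔ y + 2 ≤ s N := by omega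
      rw [left, down, lt_iff_add_two_le]
      refine ⟨fun h => ?_, fun h => ?_⟩
      · have y_lt : y < s N := by exact_mod_cast y_small.trans_lt h
        have := hs.even N
        grind
      · have : (y : ℝ) + 2 ≤ s N := by exact_mod_cast h
        linarith

theorem exists_discrete_event_of_lt_one {δ : ℝ≥0} (hδ : 0 < δ) (hδ1 : δ < 1) :
    ∃ (M : ℕ) (L c : ℤ), 0 < M ∧ 1 ≤ 2 * (δ : ℝ) ^ 2 * M ∧ L < 0 ∧ L ≤ c ∧
      ∀ s, IsNearestNeighbor s →
        (rescale δ (toPath s) ∈ O ↔ (∀ k ≤ M, L < s k) ∧ c < s M) := by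
  have one_lt_inv : 1 < 1 / (δ : ℝ) := one_lt_one_div hδ hδ1
  let T : ℝ≥0 := 1 / δ ^ 2
  let N := ⌊T⌋₊
  have N_le : (N : ℝ) ≤ T := Nat.floor_le T.2
  have T_lt : (T : ℝ) < N + 1 := Nat.lt_floor_add_one T
  have N_pos : 1 ≤ N := Nat.le_floor <| by
    rw [Nat.cast_one]
    exact (one_le_div (by positivity)).2 (pow_le_one₀ zero_le hδ1.le)
  obtain ⟨M, c, hM, c_nonneg, threshold⟩ := exists_integer_threshold (b := 1 / (δ : ℝ))
    (θ := T - N) (by linarith) (by linarith) (by linarith) N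
  have floor_neg : ⌊-(1 / (δ : ℝ))⌋ < 0 := Int.floor_lt.2 (by push_cast; linarith)
  refine ⟨M, ⌊-(1 / (δ : ℝ))⌋, c, by omega, ?_, floor_neg, by omega, fun s hs => ?_⟩
  · have T_le : (T : ℝ) ≤ 2 * M := by
      have : (N : ℝ) + 1 ≤ 2 * M := by exact_mod_cast (by omega : N + 1 ≤ 2 * M)
      linarith
    have : 1 / (δ : ℝ) ^ 2 ≤ 2 * M := by exact_mod_cast T_le
    rw [div_le_iff₀ (by positivity)] at this
    linarith
  · have above_one_iff : 1 / (δ : ℝ) < interp s T ↔ c < s M := threshold s hs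
    have mem_O_iff : rescale δ (toPath s) ∈ O ↔
        ((∀ k ≤ N, -(1 / (δ : ℝ)) < s k) ∧ -(1 / (δ : ℝ)) < interp s T) ∧
          1 / (δ : ℝ) < interp s T :=
      (rescale_mem_O_iff hδ).trans (and_congr_left' forall_lt_interp_iff)
    rw [mem_O_iff, above_one_iff]
    refine and_congr_left fun above => ?_
    have above_neg_one : -(1 / (δ : ℝ)) < interp s T := by
      linarith [above_one_iff.2 above]
    simp only [above_neg_one, and_true, ← Int.floor_lt]
    refine ⟨fun h k hk => ?_, fun h k hk => h k (hk.trans (by omega))⟩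
    rcases le_or_gt k N with hkN | hkN
    · exact h k hkN
    · obtain rfl : k = M := by omega
      omega

theorem exists_discrete_event {δ : ℝ≥0} (hδ : 0 < δ) :
    ∃ (M : ℕ) (L c : ℤ), 0 < M ∧ 1 ≤ 2 * (δ : ℝ) ^ 2 * M ∧ L < 0 ∧ L ≤ c ∧
      ∀ s, IsNearestNeighbor s →
        (rescale δ (toPath s) ∈ O ↔ (∀ k ≤ M, L < s k) ∧ c < s M) := by
  rcases lt_or_ge δ 1 with hδ1 | hδ1
  · exact exists_discrete_event_of_lt_one hδ hδ1
  · have one_le_sq : (1 : ℝ) ≤ δ ^ 2 := one_le_pow₀ hδ1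
    refine ⟨1, -1, 1, one_pos, by push_cast; linarith, by decide, by decide, fun s hs => ?_⟩
    have le_one := hs.le_natCast 1
    exact iff_of_false (notMem_O_of_one_le hδ1 hs) fun h => h.2.not_ge (by simpa using le_one)

end Event

/-! ### The decorrelation bound -/

theorem exp_neg_mul_le (D : ℝ) : Real.exp (-D) * D ≤ 1 - Real.exp (-D) := by
  have exp_mul_exp : Real.exp (-D) * Real.exp D = 1 := by
    rw [← Real.exp_add, neg_add_cancel, Real.exp_zero]
  have := mul_le_mul_of_nonneg_left (Real.add_one_le_exp D) (Real.exp_pos (-D)).le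
  linarith

theorem rpow_inv_sqrt_mul_le {δ D : ℝ} (hδ : 0 ≤ δ) (hD : 0 ≤ D) {M : ℕ} (hM : 0 < M)
    (hδM : 1 ≤ 2 * δ ^ 2 * M) :
    16 * (1 / (√M * D)) ^ (1 / 3 : ℝ) ≤ 32 * (δ / D) ^ (1 / 3 : ℝ) := by
  have hM' : (0 : ℝ) < M := by exact_mod_cast hM
  have inv_sqrt_le : 1 / √M ≤ 8 * δ := by
    rw [div_le_iff₀ (Real.sqrt_pos.2 hM')]
    rw [← one_le_sq_iff₀ (by positivity), mul_pow, mul_pow, Real.sq_sqrt hM'.le]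
    linarith
  have rpow_eight : (8 : ℝ) ^ (1 / 3 : ℝ) = 2 := by
    rw [show (8 : ℝ) = 2 ^ (3 : ℝ) by norm_num, ← Real.rpow_mul (by norm_num)]
    norm_num
  calc 16 * (1 / (√M * D)) ^ (1 / 3 : ℝ)
      ≤ 16 * (8 * (δ / D)) ^ (1 / 3 : ℝ) := by
        rw [← div_div, ← mul_div_assoc]
        gcongr
    _ = 32 * (δ / D) ^ (1 / 3 : ℝ) := by
        rw [Real.mul_rpow (by norm_num) (by positivity), rpow_eight]
        ring

theorem measureReal_rescale_mem_O_pair_le {Ω : Type*} [MeasurableSpace Ω] {P : Measure Ω}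
    [IsProbabilityMeasure P] {η : ZEven → ℕ → Ω → Bool} {N : ZEven → ℝ≥0 → Ω → ℕ}
    (h : IsDynamics P η N) {Ω' : Type*} [MeasurableSpace Ω'] {P' : Measure Ω'}
    [IsProbabilityMeasure P'] {S : ℕ → Ω' → ℤ} (hS : IsSimpleSymmetricWalk P' S)
    {δ τ τ' : ℝ≥0} (hδ : 0 < δ) (hτ : τ < τ') :
    P.real {ω | rescale δ (toPath (walk η N τ ω)) ∈ O ∧
        rescale δ (toPath (walk η N τ' ω)) ∈ O} ≤
      P'.real {ω | rescale δ (toPath (fun n => S n ω)) ∈ O} ^ 2 +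
        32 * ((δ : ℝ) / ((τ' : ℝ) - τ)) ^ (1 / 3 : ℝ) := by
  have lag_pos : 0 < (τ' : ℝ) - τ := sub_pos.2 hτ
  obtain ⟨M, L, c, hM, hδM, hL, hc, mem_O_iff⟩ := exists_discrete_event hδ
  have walk_eq : P'.real {ω | rescale δ (toPath (fun n => S n ω)) ∈ O} = survival L c M 0 := by
    rw [← hS.measureReal_survival hL hc M]
    refine measureReal_congr ?_
    filter_upwards [hS.ae_isNearestNeighbor] with ω hω using propext (mem_O_iff _ hω)
  have nearest (σ ω) : IsNearestNeighbor (walk η N σ ω) := isNearestNeighbor_pathFromOrigin _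
  simp only [walk_eq, mem_O_iff _ (nearest _ _), h.measureReal_survival_pair hτ.le hL hc M]
  calc (pairOp (Real.exp (-((τ' : ℝ) - τ))) (above L) ^ M) (survivalProd L c 0) (0, 0)
      ≤ survival L c M 0 ^ 2 + 16 * (1 / (√M * ((τ' : ℝ) - τ))) ^ (1 / 3 : ℝ) :=
        pairOp_above_pow_survivalProd_le_rpow
          ⟨(Real.exp_pos _).le, Real.exp_le_one_iff.2 (by linarith)⟩ lag_pos (exp_neg_mul_le _)
          hM hL
    _ ≤ survival L c M 0 ^ 2 + 32 * (δ / ((τ' : ℝ) - τ)) ^ (1 / 3 : ℝ) :=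
        add_le_add le_rfl (rpow_inv_sqrt_mul_le δ.2 lag_pos.le hM hδM)

end

end DyDW

theorem proposition3p1 :
    ∃ K a : ℝ, 0 < K ∧ 0 < a ∧
      ∀ {Ω : Type*} [MeasurableSpace Ω] (P : Measure Ω) [IsProbabilityMeasure P]
        (η : ZEven → ℕ → Ω → Bool) (N : ZEven → ℝ≥0 → Ω → ℕ), IsDynamics P η N →
      ∀ {Ω' : Type*} [MeasurableSpace Ω'] (P' : Measure Ω') [IsProbabilityMeasure P']
        (S : ℕ → Ω' → ℤ), IsSimpleSymmetricWalk P' S →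
      ∀ (δ τ τ' : ℝ≥0), 0 < δ → τ ≠ τ' →
        P.real {ω | rescale δ (toPath (walk η N τ ω)) ∈ O ∧
            rescale δ (toPath (walk η N τ' ω)) ∈ O} ≤
          P'.real {ω | rescale δ (toPath (fun n => S n ω)) ∈ O} ^ 2 +
            K * ((δ : ℝ) / |(τ : ℝ) - (τ' : ℝ)|) ^ a := by
  refine ⟨32, 1 / 3, by norm_num, by norm_num, ?_⟩
  intro Ω _ P _ η N h Ω' _ P' _ S hS δ τ τ' hδ hne
  rcases lt_or_gt_of_ne hne with hlt | hlt
  · rw [abs_sub_comm, abs_of_pos (sub_pos.2 (NNReal.coe_lt_coe.2 hlt))]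
    exact measureReal_rescale_mem_O_pair_le h hS hδ hlt
  · rw [abs_of_pos (sub_pos.2 (NNReal.coe_lt_coe.2 hlt))]
    simp only [and_comm (a := rescale δ (toPath (walk η N τ _)) ∈ O)]
    exact measureReal_rescale_mem_O_pair_le h hS hδ hlt
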